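/- Let $N\ge 1$, let $(\Omega,\mathscr M,\mu)$ be a probability space and let $\{T(x):\Omega\to\Omega,\ x\in\mathbb R^N\}$ be an $N$-dimensional dynamical system: $T(0)=\mathrm{id}$, $T(x+y)=T(x)\circ T(y)$, every $T(x)$ is measurable and preserves $\mu$, and for each $F\in\mathscr M$ the set $\{(x,\omega): T(x)\omega\in F\}$ belongs to the product of the $\sigma$-algebra of Lebesgue measurable sets and $\mathscr M$. Let $\Phi:[0,\infty)\to[0,\infty)$ be a Young function (continuous, convex, positive on $(0,\infty)$, $\Phi(t)/t\to0$ as $t\to0$ and $\Phi(t)/t\to\infty$ as $t\to\infty$) with conjugate $\widetilde\Phi(t)=\sup_{s\ge0}(st-\Phi(s))$, and assume that $\Phi$ and $\widetilde\Phi$ both satisfy the $\Delta_2$-condition at infinity and the $\Delta'$-condition ($\Phi(ts)\le\beta\,\Phi(t)\Phi(s)$ for all $t,s\ge0$, for some $\beta>0$). Let $Q\subset\mathbb R^N$ be open and bounded, and let $f:\Omega\times\mathbb R^N\to\mathbb R$ be such that $f(\cdot,\lambda)$ is measurable for every $\lambda$, $f(\omega,\cdot)$ is strictly convex for a.e. $\omega$,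 and, for some constants $c_1,c_2>0$, $$c_1\Phi(|\lambda|)\le f(\omega,\lambda)\le c_2(1+\Phi(|\lambda|))\qquad\text{for all }\lambda\in\mathbb R^N\text{ and a.e. }\omega\in\Omega.$$ Notation. $L^\Phi$ denotes Orlicz spaces with the Luxemburg norm. $W^1L^\Phi_{D_x}(Q;L^\Phi(\Omega))$ is the space of $v\in L^\Phi(Q\times\Omega)$ whose distributional gradient $Dv$ in $x\in Q$ belongs to $L^\Phi(Q\times\Omega)^N$. $\mathcal C^\infty(\Omega)$ is the space of $\psi\in L^\infty(\Omega)$ having stochastic derivatives $D^\alpha\psi$ in $L^\infty(\Omega)$ of all orders, where $D_i\psi=\lim_{t\to0}t^{-1}(\psi\circ T(te_i)-\psi)$ in $L^\infty(\Omega)$. $W^1_\#L^\Phi(\Omega)$ is the completion of $\mathcal C^\infty(\Omega)$ for the seminorm $\sum_i\|D_i\psi\|_{L^\Phi(\Omega)}$, and $\overline D_\omega:W^1_\#L^\Phi(\Omega)\to L^\Phi(\Omega)^N$ is the extension by continuity of $(D_1,\dots,D_N)$. $\mathbb F^1_0L^\Phi$ is the set of pairs $(u_0,u_1)$ such that $u_0$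 lies in the closure of $\mathcal C_0^\infty(Q)\otimes L^\Phi(\Omega)$ in $W^1L^\Phi_{D_x}(Q;L^\Phi(\Omega))$, $u_0(x,\cdot)$ is invariant under $T$ for a.e. $x\in Q$, and $u_1\in L^\Phi(Q;W^1_\#L^\Phi(\Omega))$. Let $(\epsilon_n)$ be a sequence in $(0,1]$ with $\epsilon_n\to0$. A sequence $(v_n)$ in $L^\Phi(Q\times\Omega)$ is weakly stochastically two-scale convergent in the mean to $v\in L^\Phi(Q\times\Omega)$ if $$\lim_{n\to\infty}\iint_{Q\times\Omega}v_n(x,\omega)\,h(x,T(\epsilon_n^{-1}x)\omega)\,dx\,d\mu=\iint_{Q\times\Omega}v\,h\,dx\,d\mu\qquad\text{for all }h\in\mathcal C_0^\infty(Q)\otimes\mathcal C^\infty(\Omega).$$ Claim. Let $(u_n)$ be a sequence in $W^1L^\Phi_{D_x}(Q;L^\Phi(\Omega))$ and let $(u_0,u_1)\in\mathbb F^1_0L^\Phi$ be such that $(Du_n)$ is, componentwise, weakly stochastically two-scale convergent in the mean to $Du_0+\overline D_\omega u_1\in L^\Phi(Q\times\Omega)^N$. Then the functions $f(\omega,Du_0+\overline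 D_\omega u_1)$ and $f(T(\epsilon_n^{-1}x)\omega,Du_n)$ are integrable on $Q\times\Omega$, and $$\iint_{Q\times\Omega}f\bigl(\omega,Du_0(x,\omega)+\overline D_\omega u_1(x,\omega)\bigr)\,dx\,d\mu\ \le\ \liminf_{n\to\infty}\iint_{Q\times\Omega}f\bigl(T(\epsilon_n^{-1}x)\omega,Du_n(x,\omega)\bigr)\,dx\,d\mu ,$$ the lower limit being taken in $[0,+\infty]$. In particular, the inequality holds with $\lim$ whenever the limit exists. -/

import Mathlib

open MeasureTheory Filter Topology Set
open scoped NNReal ENNReal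

noncomputable section

/-- The Euclidean space `ℝ^N`. -/
abbrev RN (N : ℕ) : Type := EuclideanSpace ℝ (Fin N)

/-- The `i`-th vector of the canonical basis of `ℝ^N`. -/
def basisVec {N : ℕ} (i : Fin N) : RN N := EuclideanSpace.single i 1

/-! ### Young functions -/

/-- Young functions `Φ : [0, ∞) → [0, ∞)`. -/
structure YoungFunction where
  toFun : ℝ≥0 → ℝ≥0
  continuous' : Continuous toFun
  convex' : ConvexOn ℝ≥0 univ toFun
  pos' : ∀ t, 0 < t → 0 < toFun t
  tendsto_zero' : Tendsto (fun t => toFun t / t) (𝓝[>] 0) (𝓝 0)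
  tendsto_top' : Tendsto (fun t => toFun t / t) atTop atTop

instance : CoeFun YoungFunction (fun _ => ℝ≥0 → ℝ≥0) := ⟨YoungFunction.toFun⟩

/-- The Fenchel conjugate `t ↦ sup_{s ≥ 0} (s t - Φ s)`; the supremum is taken in `ℝ`, it is
nonnegative (take `s = 0`) as soon as `Φ 0 = 0`. -/
def fenchelConj (Φ : ℝ≥0 → ℝ≥0) (t : ℝ≥0) : ℝ≥0 :=
  Real.toNNReal (⨆ s : ℝ≥0, ((s : ℝ) * (t : ℝ) - (Φ s : ℝ)))

/-- The `Δ₂`-condition (at infinity). -/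
def DeltaTwo (Φ : ℝ≥0 → ℝ≥0) : Prop :=
  ∃ t₀ k : ℝ≥0, 0 < t₀ ∧ 2 < k ∧ ∀ t, t₀ ≤ t → Φ (2 * t) ≤ k * Φ t

/-- The `Δ'`-condition. -/
def DeltaPrime (Φ : ℝ≥0 → ℝ≥0) : Prop :=
  ∃ β : ℝ≥0, 0 < β ∧ ∀ t s, Φ (t * s) ≤ β * Φ t * Φ s

namespace YoungFunction

variable (Φ : YoungFunction)

theorem map_zero : Φ 0 = 0 := by
  have h1 : Tendsto (fun t : ℝ≥0 => Φ t / t * t) (𝓝[>] 0) (𝓝 (0 * 0)) :=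
    Φ.tendsto_zero'.mul (tendsto_id.mono_left nhdsWithin_le_nhds)
  have h2 : Tendsto (fun t : ℝ≥0 => Φ t) (𝓝[>] 0) (𝓝 (0 * 0)) := by
    refine h1.congr' ?_
    filter_upwards [self_mem_nhdsWithin] with t ht
    exact div_mul_cancel₀ _ (ne_of_gt ht)
  have h3 : Tendsto (fun t : ℝ≥0 => Φ t) (𝓝[>] 0) (𝓝 (Φ 0)) :=
    (Φ.continuous'.tendsto 0).mono_left nhdsWithin_le_nhds
  simpa using tendsto_nhds_unique h3 h2

theorem map_mul_le {c : ℝ≥0} (hc : c ≤ 1) (t : ℝ≥0) : Φ (c * t) ≤ c * Φ t := by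
  have := Φ.convex'.2 (mem_univ t) (mem_univ (0 : ℝ≥0)) (zero_le : 0 ≤ c)
    (zero_le : 0 ≤ 1 - c) (add_tsub_cancel_of_le hc)
  simpa [Φ.map_zero] using this

theorem mono : Monotone Φ := by
  intro s t hst
  rcases eq_or_ne t 0 with rfl | ht
  · rw [show s = 0 from le_antisymm hst zero_le]
  · have hc : s / t ≤ 1 := div_le_one_of_le₀ hst zero_le
    calc Φ s = Φ (s / t * t) := by rw [div_mul_cancel₀ _ ht]
      _ ≤ s / t * Φ t := Φ.map_mul_le hc t
      _ ≤ 1 * Φ t := by gcongr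
      _ = Φ t := one_mul _

end YoungFunction

/-! ### Orlicz spaces -/

section Orlicz

variable {X : Type*} [MeasurableSpace X] {B : Type*} [NormedAddCommGroup B]

/-- Membership in the Orlicz space `L^Φ(ν; B)` (for `B = ℝ` the Orlicz space `L^Φ(ν)`). -/
def MemOrlicz (Φ : YoungFunction) (ν : Measure X) (u : X → B) : Prop :=
  AEStronglyMeasurable u ν ∧ ∃ δ : ℝ≥0, 0 < δ ∧ ∫⁻ x, (Φ (‖u x‖₊ / δ) : ℝ≥0∞) ∂ν < ∞

/-- The Luxemburg norm of `u`, meaningful for `u ∈ L^Φ`. -/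
def luxNorm (Φ : YoungFunction) (ν : Measure X) (u : X → B) : ℝ :=
  sInf {δ : ℝ | 0 < δ ∧ ∫⁻ x, (Φ (‖u x‖₊ / δ.toNNReal) : ℝ≥0∞) ∂ν ≤ 1}

variable {Φ : YoungFunction} {ν : Measure X}

theorem luxNorm_nonneg (u : X → B) : 0 ≤ luxNorm Φ ν u :=
  Real.sInf_nonneg (fun _ h => h.1.le)

theorem luxNorm_zero : luxNorm Φ ν (fun _ => (0 : B)) = 0 := by
  have : {δ : ℝ | 0 < δ ∧ ∫⁻ x, (Φ (‖(0 : B)‖₊ / δ.toNNReal) : ℝ≥0∞) ∂ν ≤ 1} = Ioi 0 := by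
    ext δ
    simp [Φ.map_zero]
  simp only [luxNorm]
  rw [this, csInf_Ioi]

theorem luxNorm_congr {u v : X → B} (h : u =ᵐ[ν] v) : luxNorm Φ ν u = luxNorm Φ ν v := by
  unfold luxNorm
  congr 1
  ext δ
  have : ∫⁻ x, (Φ (‖u x‖₊ / δ.toNNReal) : ℝ≥0∞) ∂ν =
      ∫⁻ x, (Φ (‖v x‖₊ / δ.toNNReal) : ℝ≥0∞) ∂ν :=
    lintegral_congr_ae (h.mono fun x hx => by simp only [hx])
  simp only [Set.mem_ofPred_eq, this]

theorem luxNorm_neg (u : X → B) : luxNorm Φ ν (fun x => -u x) = luxNorm Φ ν u := by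
  simp [luxNorm]

/-- The set defining the Luxemburg norm is non-empty on `L^Φ`. -/
theorem MemOrlicz.lux_nonempty {u : X → B} (hu : MemOrlicz Φ ν u) :
    {δ : ℝ | 0 < δ ∧ ∫⁻ x, (Φ (‖u x‖₊ / δ.toNNReal) : ℝ≥0∞) ∂ν ≤ 1}.Nonempty := by
  obtain ⟨_, δ, hδ, hI⟩ := hu
  set I := ∫⁻ x, (Φ (‖u x‖₊ / δ) : ℝ≥0∞) ∂ν with hIdef
  set K : ℝ≥0 := I.toNNReal + 1 with hK
  have hK1 : 1 ≤ K := le_add_of_nonneg_left zero_le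
  have hK0 : K ≠ 0 := (zero_lt_one.trans_le hK1).ne'
  have hKinv : K⁻¹ ≤ 1 := inv_le_one_of_one_le₀ hK1
  refine ⟨(δ * K : ℝ≥0), NNReal.coe_pos.2 (mul_pos hδ (zero_lt_one.trans_le hK1)), ?_⟩
  rw [Real.toNNReal_coe]
  calc ∫⁻ x, (Φ (‖u x‖₊ / (δ * K)) : ℝ≥0∞) ∂ν
      ≤ ∫⁻ x, (K⁻¹ : ℝ≥0) * (Φ (‖u x‖₊ / δ) : ℝ≥0∞) ∂ν := by
        refine lintegral_mono fun x => ?_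
        rw [← ENNReal.coe_mul, ENNReal.coe_le_coe]
        have : ‖u x‖₊ / (δ * K) = K⁻¹ * (‖u x‖₊ / δ) := by
          rw [div_mul_eq_div_div, div_eq_mul_inv (‖u x‖₊ / δ) K, mul_comm]
        rw [this]
        exact Φ.map_mul_le hKinv _
    _ = (K⁻¹ : ℝ≥0) * I := lintegral_const_mul' _ _ ENNReal.coe_ne_top
    _ ≤ 1 := by
        rw [← ENNReal.coe_toNNReal (show I ≠ ∞ from hI.ne), ← ENNReal.coe_mul, ← ENNReal.coe_one,
          ENNReal.coe_le_coe]
        calc K⁻¹ * I.toNNReal ≤ K⁻¹ * K := by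
              gcongr
              exact le_add_of_nonneg_right zero_le
          _ = 1 := inv_mul_cancel₀ hK0

theorem luxNorm_add_le {u v : X → B} (hu : MemOrlicz Φ ν u) (hv : MemOrlicz Φ ν v) :
    luxNorm Φ ν (fun x => u x + v x) ≤ luxNorm Φ ν u + luxNorm Φ ν v := by
  have key : ∀ a ∈ {δ : ℝ | 0 < δ ∧ ∫⁻ x, (Φ (‖u x‖₊ / δ.toNNReal) : ℝ≥0∞) ∂ν ≤ 1},
      ∀ b ∈ {δ : ℝ | 0 < δ ∧ ∫⁻ x, (Φ (‖v x‖₊ / δ.toNNReal) : ℝ≥0∞) ∂ν ≤ 1},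
      luxNorm Φ ν (fun x => u x + v x) ≤ a + b := by
    rintro a ⟨ha, hIa⟩ b ⟨hb, hIb⟩
    refine csInf_le ⟨0, fun _ h => h.1.le⟩ ⟨add_pos ha hb, ?_⟩
    lift a to ℝ≥0 using ha.le
    lift b to ℝ≥0 using hb.le
    rw [NNReal.coe_pos] at ha hb
    rw [Real.toNNReal_coe] at hIa hIb
    rw [← NNReal.coe_add, Real.toNNReal_coe]
    have hab : a / (a + b) + b / (a + b) = 1 := by
      rw [← add_div, div_self (add_pos ha hb).ne']
    have hm : AEMeasurable (fun x => ((a / (a + b) : ℝ≥0) : ℝ≥0∞) * (Φ (‖u x‖₊ / a) : ℝ≥0∞)) ν :=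
      AEMeasurable.const_mul ((Φ.continuous'.measurable.comp_aemeasurable
        (hu.1.nnnorm.aemeasurable.div_const a)).coe_nnreal_ennreal) _
    calc ∫⁻ x, (Φ (‖u x + v x‖₊ / (a + b)) : ℝ≥0∞) ∂ν
        ≤ ∫⁻ x, (((a / (a + b) : ℝ≥0) : ℝ≥0∞) * (Φ (‖u x‖₊ / a) : ℝ≥0∞)
            + ((b / (a + b) : ℝ≥0) : ℝ≥0∞) * (Φ (‖v x‖₊ / b) : ℝ≥0∞)) ∂ν := by
          refine lintegral_mono fun x => ?_
          rw [← ENNReal.coe_mul, ← ENNReal.coe_mul, ← ENNReal.coe_add, ENNReal.coe_le_coe]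
          have h1 : ‖u x + v x‖₊ / (a + b) ≤
              (a / (a + b)) • (‖u x‖₊ / a) + (b / (a + b)) • (‖v x‖₊ / b) := by
            have e1 : (a / (a + b)) • (‖u x‖₊ / a) = ‖u x‖₊ / (a + b) := by
              rw [smul_eq_mul]; field_simp
            have e2 : (b / (a + b)) • (‖v x‖₊ / b) = ‖v x‖₊ / (a + b) := by
              rw [smul_eq_mul]; field_simp
            rw [e1, e2, ← add_div]
            gcongr
            exact nnnorm_add_le _ _
          exact (Φ.mono h1).trans
            (Φ.convex'.2 (mem_univ _) (mem_univ _) zero_le zero_le hab)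
      _ = ((a / (a + b) : ℝ≥0) : ℝ≥0∞) * ∫⁻ x, (Φ (‖u x‖₊ / a) : ℝ≥0∞) ∂ν
            + ((b / (a + b) : ℝ≥0) : ℝ≥0∞) * ∫⁻ x, (Φ (‖v x‖₊ / b) : ℝ≥0∞) ∂ν := by
          rw [lintegral_add_left' hm, lintegral_const_mul' _ _ ENNReal.coe_ne_top,
            lintegral_const_mul' _ _ ENNReal.coe_ne_top]
      _ ≤ ((a / (a + b) : ℝ≥0) : ℝ≥0∞) * 1 + ((b / (a + b) : ℝ≥0) : ℝ≥0∞) * 1 := by gcongr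
      _ = 1 := by rw [mul_one, mul_one, ← ENNReal.coe_add, hab, ENNReal.coe_one]
  have h1 : ∀ a ∈ {δ : ℝ | 0 < δ ∧ ∫⁻ x, (Φ (‖u x‖₊ / δ.toNNReal) : ℝ≥0∞) ∂ν ≤ 1},
      luxNorm Φ ν (fun x => u x + v x) - a ≤ luxNorm Φ ν v := fun a ha =>
    le_csInf hv.lux_nonempty fun b hb => by linarith [key a ha b hb]
  have h2 : luxNorm Φ ν (fun x => u x + v x) - luxNorm Φ ν v ≤ luxNorm Φ ν u :=
    le_csInf hu.lux_nonempty fun a ha => by linarith [h1 a ha]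
  linarith

/-- Essentially bounded functions on a finite measure space belong to every Orlicz space. -/
theorem memOrlicz_of_memLp_top [IsFiniteMeasure ν] {u : X → B} (hu : MemLp u ∞ ν) :
    MemOrlicz Φ ν u := by
  refine ⟨hu.1, 1, one_pos, ?_⟩
  set M : ℝ≥0 := (eLpNorm u ∞ ν).toNNReal with hM
  have hb : ∀ᵐ x ∂ν, ‖u x‖₊ ≤ M := by
    have := ae_le_eLpNormEssSup (f := u) (μ := ν)
    filter_upwards [this] with x hx
    rw [← eLpNorm_exponent_top] at hx
    rw [← ENNReal.coe_le_coe, hM, ENNReal.coe_toNNReal hu.2.ne]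
    exact hx
  calc ∫⁻ x, (Φ (‖u x‖₊ / 1) : ℝ≥0∞) ∂ν ≤ ∫⁻ _, (Φ M : ℝ≥0∞) ∂ν := by
        refine lintegral_mono_ae ?_
        filter_upwards [hb] with x hx
        rw [div_one, ENNReal.coe_le_coe]
        exact Φ.mono hx
    _ < ∞ := by
        rw [lintegral_const]
        exact ENNReal.mul_lt_top ENNReal.coe_lt_top (measure_lt_top _ _)

end Orlicz

/-! ### Dynamical systems and stochastic derivatives -/

/-- An `N`-dimensional measure preserving dynamical system on `(Ω, μ)`. The maps are invertible by
the group property, and joint measurability refers to the product of the `σ`-algebra of Lebesgue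
measurable subsets of `ℝ^N` and the `σ`-algebra of `Ω`. -/
structure DynSystem (N : ℕ) {Ω : Type*} [MeasurableSpace Ω] (μ : Measure Ω) where
  toFun : RN N → Ω → Ω
  zero' : ∀ ω, toFun 0 ω = ω
  add' : ∀ x y ω, toFun (x + y) ω = toFun x (toFun y ω)
  measurePreserving' : ∀ x, MeasurePreserving (toFun x) μ μ
  measurable' : ∀ F : Set Ω, MeasurableSet F →
    @MeasurableSet (NullMeasurableSpace (RN N) volume × Ω) _
      {p : NullMeasurableSpace (RN N) volume × Ω | toFun p.1 p.2 ∈ F}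

instance {N : ℕ} {Ω : Type*} [MeasurableSpace Ω] (μ : Measure Ω) :
    CoeFun (DynSystem N μ) (fun _ => RN N → Ω → Ω) := ⟨DynSystem.toFun⟩

section Stochastic

variable {N : ℕ} {Ω : Type*} [MeasurableSpace Ω] {μ : Measure Ω}

/-- The group `U(x) f = f ∘ T(x)` on `L^∞(Ω)`. -/
def koopman (T : DynSystem N μ) (x : RN N) : Lp ℝ ∞ μ →ₗ[ℝ] Lp ℝ ∞ μ :=
  Lp.compMeasurePreservingₗ ℝ (T x) (T.measurePreserving' x)

/-- `g` is the `i`-th stochastic derivative of `f` in `L^∞(Ω)`: since `U(0) f = f`, this says that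
`(U(t e_i) f - f) / t → g` in `L^∞(Ω)` as `t → 0`. -/
def HasStochDeriv (T : DynSystem N μ) (i : Fin N) (f g : Lp ℝ ∞ μ) : Prop :=
  HasDerivAt (fun t : ℝ => koopman T (t • basisVec i) f) g 0

/-- The `i`-th stochastic derivative in `L^∞(Ω)`. -/
def stochDeriv (T : DynSystem N μ) (i : Fin N) (f : Lp ℝ ∞ μ) : Lp ℝ ∞ μ :=
  deriv (fun t : ℝ => koopman T (t • basisVec i) f) 0

/-- The space `C^∞(Ω)` of the elements of `L^∞(Ω)` that have stochastic derivatives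
`F α = D^α f` in `L^∞(Ω)` of every multi-index order `α`. -/
def smoothSpace (T : DynSystem N μ) : Submodule ℝ (Lp ℝ ∞ μ) where
  carrier := {f | ∃ F : (Fin N → ℕ) → Lp ℝ ∞ μ, F 0 = f ∧
    ∀ α i, HasStochDeriv T i (F α) (F (α + Pi.single i 1))}
  zero_mem' := ⟨fun _ => 0, rfl, fun α i => by
    simpa [HasStochDeriv] using hasDerivAt_const (0 : ℝ) (0 : Lp ℝ ∞ μ)⟩
  add_mem' := by
    rintro f g ⟨F, rfl, hF⟩ ⟨G, rfl, hG⟩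
    refine ⟨fun α => F α + G α, rfl, fun α i => ?_⟩
    simpa [HasStochDeriv] using (hF α i).fun_add (hG α i)
  smul_mem' := by
    rintro c f ⟨F, rfl, hF⟩
    refine ⟨fun α => c • F α, rfl, fun α i => ?_⟩
    simpa [HasStochDeriv] using (hF α i).fun_const_smul c

theorem smoothSpace.hasStochDeriv {T : DynSystem N μ} {f : Lp ℝ ∞ μ} (hf : f ∈ smoothSpace T)
    (i : Fin N) : HasStochDeriv T i f (stochDeriv T i f) := by
  obtain ⟨F, rfl, hF⟩ := hf
  exact (hF 0 i).differentiableAt.hasDerivAt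

/-- Copy of `C^∞(Ω)` that carries the seminorm `‖·‖_{#,Φ}`. -/
def SharpSpace (_Φ : YoungFunction) (T : DynSystem N μ) : Type _ := smoothSpace T

namespace SharpSpace

variable {Φ : YoungFunction} {T : DynSystem N μ}

instance : AddCommGroup (SharpSpace Φ T) := inferInstanceAs (AddCommGroup (smoothSpace T))

/-- The underlying element of `L^∞(Ω)`. -/
def val (ψ : SharpSpace Φ T) : Lp ℝ ∞ μ := Subtype.val (p := (· ∈ smoothSpace T)) ψ

theorem hasStochDeriv (ψ : SharpSpace Φ T) (i : Fin N) :
    HasStochDeriv T i ψ.val (stochDeriv T i ψ.val) :=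
  smoothSpace.hasStochDeriv ψ.2 i

theorem stochDeriv_zero (i : Fin N) : stochDeriv T i (0 : SharpSpace Φ T).val = 0 := by
  have : (0 : SharpSpace Φ T).val = 0 := rfl
  simp [stochDeriv, this]

theorem stochDeriv_add (ψ χ : SharpSpace Φ T) (i : Fin N) :
    stochDeriv T i (ψ + χ).val = stochDeriv T i ψ.val + stochDeriv T i χ.val := by
  have : (ψ + χ).val = ψ.val + χ.val := rfl
  have h := (HasDerivAt.fun_add (ψ.hasStochDeriv i) (χ.hasStochDeriv i)).deriv
  simpa [stochDeriv, this] using h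

theorem stochDeriv_neg (ψ : SharpSpace Φ T) (i : Fin N) :
    stochDeriv T i (-ψ).val = -stochDeriv T i ψ.val := by
  have : (-ψ).val = -ψ.val := rfl
  simp [stochDeriv, this]

/-- The seminorm `‖ψ‖_{#,Φ} = ∑ᵢ ‖Dᵢ ψ‖_{L^Φ(Ω)}` on `C^∞(Ω)`. -/
def seminorm [IsProbabilityMeasure μ] (Φ : YoungFunction) (T : DynSystem N μ) :
    AddGroupSeminorm (SharpSpace Φ T) where
  toFun ψ := ∑ i, luxNorm Φ μ (stochDeriv T i ψ.val)
  map_zero' := by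
    refine Finset.sum_eq_zero fun i _ => ?_
    rw [stochDeriv_zero, luxNorm_congr (Lp.coeFn_zero ℝ ∞ μ)]
    exact luxNorm_zero
  add_le' ψ χ := by
    rw [← Finset.sum_add_distrib]
    refine Finset.sum_le_sum fun i _ => ?_
    rw [stochDeriv_add, luxNorm_congr (Lp.coeFn_add _ _)]
    exact luxNorm_add_le (memOrlicz_of_memLp_top (Lp.memLp _))
      (memOrlicz_of_memLp_top (Lp.memLp _))
  neg' ψ := by
    refine Finset.sum_congr rfl fun i _ => ?_
    rw [stochDeriv_neg, luxNorm_congr (Lp.coeFn_neg _)]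
    exact luxNorm_neg _

instance [IsProbabilityMeasure μ] : SeminormedAddCommGroup (SharpSpace Φ T) :=
  (seminorm Φ T).toSeminormedAddCommGroup

end SharpSpace

/-- The space `W¹_# L^Φ(Ω)`: the completion of `C^∞(Ω)` for the seminorm `‖·‖_{#,Φ}`. -/
abbrev WSharp [IsProbabilityMeasure μ] (Φ : YoungFunction) (T : DynSystem N μ) : Type _ :=
  UniformSpace.Completion (SharpSpace Φ T)

/-- `g` is (a version of) `D̄_ω U`, where `D̄_ω : W¹_# L^Φ(Ω) → L^Φ(Ω)^N` is the extension by
continuity of the stochastic gradient on `C^∞(Ω)`. -/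
def HasSharpGradient [IsProbabilityMeasure μ] (Φ : YoungFunction) (T : DynSystem N μ)
    (U : WSharp Φ T) (g : Ω → RN N) : Prop :=
  (∀ i, MemOrlicz Φ μ (fun ω => g ω i)) ∧
  ∃ ψ : ℕ → SharpSpace Φ T,
    Tendsto (fun k => (ψ k : WSharp Φ T)) atTop (𝓝 U) ∧
    ∀ i, Tendsto (fun k => luxNorm Φ μ (fun ω => stochDeriv T i (ψ k).val ω - g ω i))
      atTop (𝓝 0)

/-- The space `I_nv^Φ(Ω)` of the functions in `L^Φ(Ω)` that are invariant for `T`. -/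
def MemInvariant (Φ : YoungFunction) (T : DynSystem N μ) (g : Ω → ℝ) : Prop :=
  MemOrlicz Φ μ g ∧ ∀ x : RN N, (fun ω => g (T x ω)) =ᵐ[μ] g

/-! ### Function spaces on `Q × Ω` -/

/-- `φ ∈ C_0^∞(Q)`. -/
def IsTestFunction (Q : Set (RN N)) (φ : RN N → ℝ) : Prop :=
  ContDiff ℝ ((⊤ : ℕ∞) : WithTop ℕ∞) φ ∧ HasCompactSupport φ ∧ tsupport φ ⊆ Q

/-- `w ∈ C_0^∞(Q) ⊗ S`, for a class `S` of functions on `Ω`: finite sums of `φ_j(x) a_j(ω)`. -/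
def IsTensor (Q : Set (RN N)) (S : Set (Ω → ℝ)) (w : RN N × Ω → ℝ) : Prop :=
  ∃ (m : ℕ) (φ : Fin m → RN N → ℝ) (a : Fin m → Ω → ℝ),
    (∀ j, IsTestFunction Q (φ j)) ∧ (∀ j, a j ∈ S) ∧ w = fun p => ∑ j, φ j p.1 * a j p.2

/-- The measure `dx ⊗ μ` on `Q × Ω`. -/
def cylMeasure (Q : Set (RN N)) (μ : Measure Ω) : Measure (RN N × Ω) :=
  (volume.restrict Q).prod μ

/-- `G ∈ L^Φ(Q × Ω)^N` is the distributional gradient of `v` with respect to `x ∈ Q`. -/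
def HasWeakGradient (Φ : YoungFunction) (Q : Set (RN N)) (μ : Measure Ω)
    (v : RN N × Ω → ℝ) (G : RN N × Ω → RN N) : Prop :=
  (∀ i, MemOrlicz Φ (cylMeasure Q μ) (fun p => G p i)) ∧
  ∀ φ : RN N → ℝ, IsTestFunction Q φ → ∀ i, ∀ᵐ ω ∂μ,
    ∫ x in Q, v (x, ω) * fderiv ℝ φ x (basisVec i) = -∫ x in Q, G (x, ω) i * φ x

/-- `v ∈ W¹L^Φ_{D_x}(Q; L^Φ(Ω))`. -/
def MemW1 (Φ : YoungFunction) (Q : Set (RN N)) (μ : Measure Ω) (v : RN N × Ω → ℝ) : Prop :=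
  MemOrlicz Φ (cylMeasure Q μ) v ∧ ∃ G, HasWeakGradient Φ Q μ v G

/-- `v ∈ W¹_0L^Φ_{D_x}(Q; L^Φ(Ω))`: the closure of `C_0^∞(Q) ⊗ L^Φ(Ω)` in
`W¹L^Φ_{D_x}(Q; L^Φ(Ω))`. -/
def MemW10 (Φ : YoungFunction) (Q : Set (RN N)) (μ : Measure Ω) (v : RN N × Ω → ℝ) : Prop :=
  MemOrlicz Φ (cylMeasure Q μ) v ∧ ∃ G, HasWeakGradient Φ Q μ v G ∧
    ∃ (w : ℕ → RN N × Ω → ℝ) (H : ℕ → RN N × Ω → RN N),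
      (∀ k, IsTensor Q {a | MemOrlicz Φ μ a} (w k)) ∧
      (∀ k, HasWeakGradient Φ Q μ (w k) (H k)) ∧
      Tendsto (fun k => luxNorm Φ (cylMeasure Q μ) (fun p => w k p - v p)) atTop (𝓝 0) ∧
      ∀ i, Tendsto (fun k => luxNorm Φ (cylMeasure Q μ) (fun p => H k p i - G p i)) atTop (𝓝 0)

/-- `v ∈ W¹_0L^Φ_{D_x}(Q; I_nv^Φ(Ω))`. -/
def MemW10Inv (Φ : YoungFunction) (Q : Set (RN N)) (T : DynSystem N μ)
    (v : RN N × Ω → ℝ) : Prop :=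
  MemW10 Φ Q μ v ∧ ∀ᵐ x ∂(volume.restrict Q), MemInvariant Φ T (fun ω => v (x, ω))

/-- `(u₀, u₁) ∈ 𝔽¹_0L^Φ = W¹_0L^Φ_{D_x}(Q; I_nv^Φ(Ω)) × L^Φ(Q; W¹_#L^Φ(Ω))`. -/
def MemF10 [IsProbabilityMeasure μ] (Φ : YoungFunction) (Q : Set (RN N)) (T : DynSystem N μ)
    (u₀ : RN N × Ω → ℝ) (u₁ : RN N → WSharp Φ T) : Prop :=
  MemW10Inv Φ Q T u₀ ∧ MemOrlicz Φ (volume.restrict Q) u₁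

/-- `G` is `(x, ω) ↦ (D̄_ω u₁(x))(ω)`, as an element of `L^Φ(Q × Ω)^N`. -/
def IsSharpGradientField [IsProbabilityMeasure μ] (Φ : YoungFunction) (Q : Set (RN N))
    (T : DynSystem N μ) (u₁ : RN N → WSharp Φ T) (G : RN N × Ω → RN N) : Prop :=
  (∀ i, MemOrlicz Φ (cylMeasure Q μ) (fun p => G p i)) ∧
  ∀ᵐ x ∂(volume.restrict Q), HasSharpGradient Φ T (u₁ x) (fun ω => G (x, ω))

/-! ### Stochastic two-scale convergence in the mean -/

/-- Fundamental sequences of scales. -/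
def IsFundamentalSequence (ε : ℕ → ℝ) : Prop :=
  (∀ n, 0 < ε n ∧ ε n ≤ 1) ∧ Tendsto ε atTop (𝓝 0)

/-- Weak stochastic two-scale convergence in the mean of `(v_n)` to `v` in `L^Φ(Q × Ω)`, along
the scales `ε n`; the test functions run through `C_0^∞(Q) ⊗ C^∞(Ω)`. -/
def StochTwoScaleTendsto (Φ : YoungFunction) (Q : Set (RN N)) (T : DynSystem N μ)
    (ε : ℕ → ℝ) (v : ℕ → RN N × Ω → ℝ) (v₀ : RN N × Ω → ℝ) : Prop :=
  (∀ n, MemOrlicz Φ (cylMeasure Q μ) (v n)) ∧ MemOrlicz Φ (cylMeasure Q μ) v₀ ∧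
  ∀ h : RN N × Ω → ℝ, IsTensor Q {a | ∃ ψ ∈ smoothSpace T, a =ᵐ[μ] ψ} h →
    Tendsto (fun n => ∫ p, v n p * h (p.1, T ((ε n)⁻¹ • p.1) p.2) ∂(cylMeasure Q μ)) atTop
      (𝓝 (∫ p, v₀ p * h p ∂(cylMeasure Q μ)))

end Stochastic

end

/-! The shear `(x, ω) ↦ (x, T(x/ε) ω)` preserves `dx ⊗ μ`, because each of its sections at fixed `x`
preserves `μ`. Composing `Du n` with the inverse shear gives fields `W n` for which the oscillating
functional becomes `∫ f(ω, W n)`, with an integrand independent of `n`, and two-scale convergence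
becomes convergence of `∫ W n · h` for fixed `h ∈ C_0^∞(Q) ⊗ C^∞(Ω)`. What remains is weak lower
semicontinuity of a convex integral functional.

Suppose the inequality fails. Then for some real `c` below the left side the functionals are less
than `c` for infinitely many `n`. Along these `n` the lower growth bound controls `∫ Φ(‖W n‖)`, and
superlinearity of `Φ` makes `W n` equiintegrable (`exists_abs_integral_mul_le`). Test functions may
then be replaced by their bounded a.e. limits, so the integrals of `W n` converge over every
measurable set (`tendsto_setIntegral_of_isTensor`). This needs `C^∞(Ω)` to be rich enough:
indicators are mollified along orbits, and the mollifications converge almost surely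
(`exists_smoothSpace_tendsto_indicator`).

Finally `f` is a supremum of countably many affine minorants `⟪q, ξ⟫ + b_q(ω)`. Integrals of these
pass to the limit, a maximum of finitely many is treated by cutting the domain into measurable
pieces, and monotone convergence recovers `f` (`integral_le_of_tendsto`). This contradicts the
choice of `c`.

Joint measurability of `T` refers to the Lebesgue σ-algebra, so the shear is only null measurable;
it is handled as a map out of the completed measure space. -/

section Completion

/-! ### Maps that preserve a measure after completion. -/

variable {α β E : Type*} [MeasurableSpace α] [MeasurableSpace β]

/-- The identity map, from a measure space with its `σ`-algebra completed. -/
def ofNullMeasurableSpace (ν : Measure α) : NullMeasurableSpace α ν → α := fun a => a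

/-- Measurability for the completed σ-algebra is null measurability, which for values in a second
countable pseudometrizable space is a.e. strong measurability. -/
theorem aestronglyMeasurable_of_completion [TopologicalSpace E]
    [TopologicalSpace.PseudoMetrizableSpace E] [SecondCountableTopology E]
    {ν : Measure α} {g : α → E}
    (hg : AEStronglyMeasurable (fun a => g (ofNullMeasurableSpace ν a)) ν.completion) :
    AEStronglyMeasurable g ν := by
  borelize E
  obtain ⟨k, hk, hgk⟩ := hg
  have hk' : @NullMeasurable α E _ _ k ν := fun s hs => hk.measurable hs
  have h2 : NullMeasurable g ν :=
    NullMeasurable.congr (α := α) (f := k) (g := g) (μ := ν) hk' hgk.symm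
  exact h2.aemeasurable.aestronglyMeasurable

theorem measurePreserving_id_completion (ν : Measure α) :
    MeasurePreserving (ofNullMeasurableSpace ν) ν.completion ν := by
  have hm : Measurable (ofNullMeasurableSpace ν) :=
    fun s hs => @MeasurableSet.nullMeasurableSet α _ ν s hs
  refine ⟨hm, ?_⟩
  ext s hs
  rw [Measure.map_apply hm hs]
  exact Measure.completion_apply ν s

/-- Both coordinate projections are measurable from the completed product, hence so is the identity
into the product of the completed first factor with the second. -/
theorem nullMeasurableSet_of_prod_nullMeasurableSpace {ν : Measure α} {μ : Measure β}
    [SFinite ν] [SFinite μ] {s : Set (α × β)}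
    (hs : @MeasurableSet (NullMeasurableSpace α ν × β) _ s) :
    NullMeasurableSet s (ν.prod μ) := by
  let pr₁ : NullMeasurableSpace (α × β) (ν.prod μ) → NullMeasurableSpace α ν :=
    Prod.fst (α := α) (β := β)
  let pr₂ : NullMeasurableSpace (α × β) (ν.prod μ) → β := Prod.snd (α := α) (β := β)
  have h1 : Measurable pr₁ := fun t ht =>
    (show @NullMeasurableSet α _ t ν from ht).preimage
      Measure.quasiMeasurePreserving_fst
  have h2 : Measurable pr₂ := fun t ht =>
    @MeasurableSet.nullMeasurableSet (α × β) _ (ν.prod μ) _ (measurable_snd ht)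
  exact (h1.prodMk h2) hs

/-- `S` preserves `ν`, and preimages of measurable sets are null measurable. -/
def CompletionPreserving (S : α → α) (ν : Measure α) : Prop :=
  MeasurePreserving (fun a => S (ofNullMeasurableSpace ν a)) ν.completion ν

namespace CompletionPreserving

variable {S : α → α} {ν : Measure α}

theorem ae (hS : CompletionPreserving S ν) {P : α → Prop} (hP : ∀ᵐ a ∂ν, P a) :
    ∀ᵐ a ∂ν, P (S a) :=
  hS.quasiMeasurePreserving.ae hP

theorem aestronglyMeasurable_comp [TopologicalSpace E]
    [TopologicalSpace.PseudoMetrizableSpace E] [SecondCountableTopology E]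
    (hS : CompletionPreserving S ν) {g : α → E} (hg : AEStronglyMeasurable g ν) :
    AEStronglyMeasurable (fun a => g (S a)) ν :=
  aestronglyMeasurable_of_completion (hg.comp_measurePreserving hS)

/-- Both sides equal one integral over the completion: `key` is used once for the identity map out
of the completion and once for `S`. -/
theorem integral_comp (hS : CompletionPreserving S ν) {g : α → ℝ}
    (hg : AEStronglyMeasurable g ν) : ∫ a, g (S a) ∂ν = ∫ a, g a ∂ν := by
  have key {R : NullMeasurableSpace α ν → α} (hR : MeasurePreserving R ν.completion ν)
      {k : α → ℝ} (hk : AEStronglyMeasurable k ν) :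
      ∫ a, k (R a) ∂ν.completion = ∫ a, k a ∂ν := by
    rw [← integral_map hR.measurable.aemeasurable (by rwa [hR.map_eq]), hR.map_eq]
  exact (key (measurePreserving_id_completion ν) (hS.aestronglyMeasurable_comp hg)).symm.trans
    (key hS hg)

theorem lintegral_comp (hS : CompletionPreserving S ν) {g : α → ℝ≥0∞}
    (hg : AEMeasurable g ν) : ∫⁻ a, g (S a) ∂ν = ∫⁻ a, g a ∂ν := by
  have key {R : NullMeasurableSpace α ν → α} (hR : MeasurePreserving R ν.completion ν)
      {k : α → ℝ≥0∞} (hk : AEMeasurable k ν) :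
      ∫⁻ a, k (R a) ∂ν.completion = ∫⁻ a, k a ∂ν := by
    rw [← lintegral_map' (by rwa [hR.map_eq]) hR.measurable.aemeasurable, hR.map_eq]
  exact (key (measurePreserving_id_completion ν)
    (hS.aestronglyMeasurable_comp hg.aestronglyMeasurable).aemeasurable).symm.trans (key hS hg)

theorem integrable_comp (hS : CompletionPreserving S ν) {g : α → ℝ}
    (hg : Integrable g ν) : Integrable (fun a => g (S a)) ν := by
  refine ⟨hS.aestronglyMeasurable_comp hg.1, ?_⟩
  exact (hS.lintegral_comp hg.1.enorm).trans_lt hg.2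

end CompletionPreserving

end Completion

/-! ### The shear of `ℝ^N × Ω` along the flow. -/

namespace DynSystem

variable {N : ℕ} {Ω : Type*} [MeasurableSpace Ω] {μ : Measure Ω}
  (T : DynSystem N μ)

theorem nullMeasurableSet_preimage [SFinite μ] {c : ℝ} (hc : c ≠ 0) {F : Set Ω}
    (hF : MeasurableSet F) :
    NullMeasurableSet {p : RN N × Ω | T (c • p.1) p.2 ∈ F} ((volume : Measure (RN N)).prod μ) := by
  have h1 : NullMeasurableSet {p : RN N × Ω | T p.1 p.2 ∈ F} ((volume : Measure (RN N)).prod μ) :=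
    @nullMeasurableSet_of_prod_nullMeasurableSpace (RN N) Ω _ _ volume μ _ _ _
      (T.measurable' F hF)
  have h2 : Measure.QuasiMeasurePreserving (fun x : RN N => c • x)
      (volume : Measure (RN N)) (volume : Measure (RN N)) := by
    refine ⟨measurable_const_smul c, ?_⟩
    refine Measure.AbsolutelyContinuous.mk fun s hs h0 => ?_
    rw [Measure.map_apply (measurable_const_smul c) hs, Measure.addHaar_preimage_smul _ hc, h0,
      mul_zero]
  have h3 : Measure.QuasiMeasurePreserving (Prod.map (fun x : RN N => c • x) (id : Ω → Ω))
      ((volume : Measure (RN N)).prod μ) ((volume : Measure (RN N)).prod μ) := by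
    refine ⟨h2.measurable.prodMap measurable_id, ?_⟩
    have := Measure.map_prod_map (volume : Measure (RN N)) μ h2.measurable measurable_id
    rw [← this, Measure.map_id]
    exact h2.absolutelyContinuous.prod Measure.AbsolutelyContinuous.rfl
  exact h1.preimage h3

/-- The transformation `(x, ω) ↦ (x, T(c x) ω)`. -/
def shear (c : ℝ) (p : RN N × Ω) : RN N × Ω := (p.1, T (c • p.1) p.2)

theorem shear_neg_shear (c : ℝ) (p : RN N × Ω) : T.shear (-c) (T.shear c p) = p := by
  simp only [shear, ← T.add', neg_smul, neg_add_cancel, T.zero']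

theorem shear_shear_neg (c : ℝ) (p : RN N × Ω) : T.shear c (T.shear (-c) p) = p := by
  simpa using T.shear_neg_shear (-c) p

/-- By Fubini: at fixed `x` the shear acts on `ω` as `T (c • x)`, which preserves `μ`. -/
theorem completionPreserving_shear [SFinite μ] {ν₀ : Measure (RN N)} [SFinite ν₀]
    (hν₀ : ν₀ ≪ volume) {c : ℝ} (hc : c ≠ 0) :
    CompletionPreserving (T.shear c) (ν₀.prod μ) := by
  let I := ofNullMeasurableSpace (ν₀.prod μ)
  have h1 : Measurable (fun p => (I p).1) := fun s hs =>
    @MeasurableSet.nullMeasurableSet (RN N × Ω) _ (ν₀.prod μ) _ (measurable_fst hs)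
  have h2 : Measurable (fun p => (T.shear c (I p)).2) := fun s hs =>
    (T.nullMeasurableSet_preimage hc hs).mono_ac
      (hν₀.prod Measure.AbsolutelyContinuous.rfl)
  have hm : Measurable (fun p => T.shear c (I p)) :=
    h1.prodMk h2
  refine ⟨hm, ?_⟩
  ext E hE
  rw [Measure.map_apply hm hE]
  have hn : NullMeasurableSet (T.shear c ⁻¹' E) (ν₀.prod μ) := hm hE
  change (ν₀.prod μ) (T.shear c ⁻¹' E) = _
  rw [← lintegral_indicator_one₀ hn,
    ← lintegral_indicator_one hE, lintegral_prod _ ((measurable_one.aemeasurable).indicator₀ hn),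
    lintegral_prod _ ((measurable_one.aemeasurable).indicator hE)]
  refine lintegral_congr fun x => ?_
  have := (T.measurePreserving' (c • x)).lintegral_comp
    (f := fun ω => E.indicator (1 : RN N × Ω → ℝ≥0∞) (x, ω))
    ((measurable_one.indicator hE).comp measurable_prodMk_left)
  rw [← this]
  rfl

theorem nullMeasurable_orbit {F : Set Ω} (hF : MeasurableSet F) (ω : Ω) :
    NullMeasurableSet {x : RN N | T x ω ∈ F} volume := by
  have := measurable_prodMk_right (α := NullMeasurableSpace (RN N) volume) (y := ω)
    (T.measurable' F hF)
  exact this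

/-- A property that holds at almost every point of almost every trajectory holds almost surely. -/
theorem ae_of_ae_orbit [SFinite μ] {P : Ω → Prop} (hP : NullMeasurableSet {ω | P ω} μ)
    (h : ∀ᵐ ω ∂μ, ∀ᵐ x : RN N, P (T x ω)) : ∀ᵐ ω ∂μ, P ω := by
  have hS := T.completionPreserving_shear (ν₀ := volume)
    Measure.AbsolutelyContinuous.rfl one_ne_zero
  -- The property is replaced by an a.e. equal measurable set, for which the joint measurability of
  -- `T` is available.
  obtain ⟨E, hE, hEP⟩ := hP
  have hEP' : ∀ᵐ ω ∂μ, (ω ∈ E ↔ P ω) := hEP.symm.mem_iff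
  have h1 : ∀ᵐ p : RN N × Ω ∂((volume : Measure (RN N)).prod μ),
      (T p.1 p.2 ∈ E ↔ P (T p.1 p.2)) := by
    have := hS.ae (Measure.quasiMeasurePreserving_snd.ae hEP')
    simpa [shear] using this
  have h2 : ∀ᵐ ω ∂μ, ∀ᵐ x : RN N, T x ω ∈ E := by
    have h1' := (Measure.measurePreserving_swap (μ := μ)
      (ν := (volume : Measure (RN N)))).quasiMeasurePreserving.ae h1
    filter_upwards [h, Measure.ae_ae_of_ae_prod h1'] with ω hω hω'
    filter_upwards [hω, hω'] with x hx hx' using hx'.2 hx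
  have hn : NullMeasurableSet {p : RN N × Ω | T p.1 p.2 ∈ Eᶜ} (volume.prod μ) := by
    simpa using T.nullMeasurableSet_preimage one_ne_zero hE.compl
  have h3 : (volume.prod μ) {p : RN N × Ω | T p.1 p.2 ∈ Eᶜ} = 0 := by
    rw [← lintegral_indicator_one₀ hn,
      lintegral_prod_symm _ ((measurable_one.aemeasurable).indicator₀ hn)]
    rw [lintegral_eq_zero_of_ae_eq_zero]
    filter_upwards [h2] with ω hω
    refine lintegral_eq_zero_of_ae_eq_zero ?_
    filter_upwards [hω] with x hx
    simp [hx]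
  have h4 : ∀ᵐ p : RN N × Ω ∂((volume : Measure (RN N)).prod μ), T p.1 p.2 ∈ E := by
    rw [ae_iff]; exact h3
  -- One good `x` suffices: `T x` carries `μ` to itself, so almost sure membership of `T x ω` gives
  -- that of `ω`.
  obtain ⟨x, hx⟩ := (Measure.ae_ae_of_ae_prod h4).exists
  have h5 : ∀ᵐ ω ∂μ, ω ∈ E := by
    rw [← (T.measurePreserving' x).map_eq,
      ae_map_iff (p := (· ∈ E)) (T.measurePreserving' x).measurable.aemeasurable hE]
    exact hx
  filter_upwards [h5, hEP'] with ω h h' using h'.1 h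

end DynSystem

/-! ### Multi-index powers of commuting operators. -/

section CommutingOperators

/-- Take `F α = (∏ D i ^ α i) • x`; commutation makes the product independent of the order. This
supplies the derivatives of all orders that `smoothSpace` asks for. -/
theorem exists_multiindex_action {ι M X : Type*} [Fintype ι] [DecidableEq ι] [Monoid M]
    [MulAction M X] (D : ι → M) (hD : ∀ i j, Commute (D i) (D j)) (x : X) :
    ∃ F : (ι → ℕ) → X, F 0 = x ∧ ∀ α i, F (α + Pi.single i 1) = D i • F α := by
  have hc : ∀ (α : ι → ℕ) (s : Finset ι),
      (s : Set ι).Pairwise (Function.onFun Commute fun i => D i ^ α i) :=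
    fun α s i _ j _ _ => (hD i j).pow_pow _ _
  refine ⟨fun α => Finset.univ.noncommProd (fun i => D i ^ α i) (hc α _) • x, ?_, fun α i => ?_⟩
  · have : Finset.univ.noncommProd (fun i => D i ^ (0 : ι → ℕ) i) (hc 0 _) = 1 := by
      rw [Finset.noncommProd_eq_pow_card _ _ _ 1 (by simp)]; simp
    change Finset.univ.noncommProd (fun i => D i ^ (0 : ι → ℕ) i) (hc 0 _) • x = x
    rw [this, one_smul]
  · change Finset.univ.noncommProd (fun j => D j ^ (α + Pi.single i 1 : ι → ℕ) j) (hc _ _) • x =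
      D i • Finset.univ.noncommProd (fun i => D i ^ α i) (hc α _) • x
    rw [← mul_smul]
    congr 1
    rw [← Finset.mul_noncommProd_erase _ (Finset.mem_univ i) _ (hc _ _),
      ← Finset.mul_noncommProd_erase _ (Finset.mem_univ i) _ (hc α _), ← mul_assoc]
    congr 1
    · simp [pow_succ']
    · refine Finset.noncommProd_congr rfl (fun j hj => ?_) _
      have : j ≠ i := Finset.ne_of_mem_erase hj
      simp [this]

end CommutingOperators

/-! ### Smooth kernels and their translates in `L¹`. -/

section TestFunctions

variable {N : ℕ}

/-- Smooth compactly supported functions on `ℝ^N`. -/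
def smoothCompact (N : ℕ) : Submodule ℝ (RN N → ℝ) where
  carrier := {ρ | ContDiff ℝ ((⊤ : ℕ∞) : WithTop ℕ∞) ρ ∧ HasCompactSupport ρ}
  zero_mem' := ⟨contDiff_const, HasCompactSupport.zero⟩
  add_mem' := fun h h' => ⟨h.1.add h'.1, h.2.add h'.2⟩
  smul_mem' := fun c _ h => ⟨contDiff_const.smul h.1, h.2.smul_left (f := fun _ => c)⟩

namespace smoothCompact

theorem contDiff (ρ : smoothCompact N) : ContDiff ℝ ((⊤ : ℕ∞) : WithTop ℕ∞) ρ.1 := ρ.2.1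

theorem hasCompactSupport (ρ : smoothCompact N) : HasCompactSupport ρ.1 := ρ.2.2

theorem continuous (ρ : smoothCompact N) : Continuous ρ.1 := (contDiff ρ).continuous

theorem differentiable (ρ : smoothCompact N) : Differentiable ℝ ρ.1 :=
  (contDiff ρ).differentiable (by simp)

theorem integrable (ρ : smoothCompact N) : Integrable ρ.1 :=
  (continuous ρ).integrable_of_hasCompactSupport (hasCompactSupport ρ)

/-- The operator `-∂ᵢ` on smooth compactly supported functions. -/
noncomputable def negPartial (i : Fin N) : Module.End ℝ (smoothCompact N) where
  toFun ρ := ⟨fun y => -fderiv ℝ ρ.1 y (basisVec i),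
    (((contDiff ρ).fderiv_right (m := ((⊤ : ℕ∞) : WithTop ℕ∞)) (by simp)).clm_apply
      contDiff_const).neg, ((hasCompactSupport ρ).fderiv_apply ℝ (basisVec i)).neg⟩
  map_add' ρ σ := by
    ext y
    simp only [Submodule.coe_add, Pi.add_apply]
    rw [fderiv_add ((differentiable ρ) y) ((differentiable σ) y)]
    simp [add_comm]
  map_smul' c ρ := by
    ext y
    simp only [SetLike.val_smul, Pi.smul_apply, RingHom.id_apply]
    rw [fderiv_const_smul ((differentiable ρ) y)]
    simp

theorem negPartial_apply (i : Fin N) (ρ : smoothCompact N) (y : RN N) :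
    (negPartial i ρ).1 y = -fderiv ℝ ρ.1 y (basisVec i) := rfl

theorem negPartial_commute (i j : Fin N) : Commute (negPartial (N := N) i) (negPartial j) := by
  ext ρ y
  have hd : Differentiable ℝ (fderiv ℝ ρ.1) :=
    ((contDiff ρ).fderiv_right (m := ((⊤ : ℕ∞) : WithTop ℕ∞)) (by simp)).differentiable (by simp)
  have key : ∀ i j : Fin N, (negPartial i (negPartial j ρ)).1 y =
      fderiv ℝ (fderiv ℝ ρ.1) y (basisVec i) (basisVec j) := fun i j => by
    rw [negPartial_apply]
    have : (negPartial j ρ).1 = fun y => -fderiv ℝ ρ.1 y (basisVec j) := rfl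
    rw [this, fderiv_fun_neg, fderiv_clm_apply (hd y) (differentiableAt_const _)]
    simp
  change (negPartial i (negPartial j ρ)).1 y = (negPartial j (negPartial i ρ)).1 y
  rw [key, key]
  exact second_derivative_symmetric (fun z => ((differentiable ρ) z).hasFDerivAt)
    (hd y).hasFDerivAt _ _

theorem exists_multiindex (ρ : smoothCompact N) :
    ∃ F : (Fin N → ℕ) → smoothCompact N, F 0 = ρ ∧
      ∀ α i, F (α + Pi.single i 1) = negPartial i (F α) :=
  exists_multiindex_action (M := Module.End ℝ (smoothCompact N)) negPartial negPartial_commute ρ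

/-- Translation in the direction `-eᵢ` is differentiable in `L¹`, with derivative `-∂ᵢ`. -/
theorem tendsto_integral_translate_sub (ρ : smoothCompact N) (i : Fin N) :
    Tendsto (fun t : ℝ => |t|⁻¹ *
      ∫ y, |ρ.1 (y - t • basisVec i) - ρ.1 y - t * (negPartial i ρ).1 y|) (𝓝 0) (𝓝 0) := by
  obtain ⟨K, hK⟩ := ContDiff.lipschitzWith_of_hasCompactSupport (hasCompactSupport ρ)
    (contDiff ρ) (by simp)
  set e : RN N := basisVec i with he
  -- Dominating function for `|t| ≤ 1`: off the `‖e‖`-thickening of the support everything vanishes,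
  -- and a Lipschitz constant `K` bounds both the increment and the derivative term by `|t| K ‖e‖`.
  have hK' : Integrable ((Metric.cthickening ‖e‖ (tsupport ρ.1)).indicator
      (fun _ : RN N => 2 * (K * ‖e‖))) := by
    rw [integrable_indicator_iff Metric.isClosed_cthickening.measurableSet]
    exact integrableOn_const ((hasCompactSupport ρ).isCompact.cthickening.measure_lt_top.ne)
  have hbd : ∀ᶠ t : ℝ in 𝓝 0, ∀ y,
      ‖|t|⁻¹ * |ρ.1 (y - t • e) - ρ.1 y - t * (negPartial i ρ).1 y|‖ ≤
      (Metric.cthickening ‖e‖ (tsupport ρ.1)).indicator (fun _ : RN N => 2 * (K * ‖e‖)) y := by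
    filter_upwards [Metric.closedBall_mem_nhds (0 : ℝ) one_pos] with t ht y
    have ht : |t| ≤ 1 := by simpa using ht
    have hnn : 0 ≤ 2 * ((K : ℝ) * ‖e‖) := by positivity
    rw [norm_mul, norm_inv, Real.norm_eq_abs, Real.norm_eq_abs, abs_abs, abs_abs]
    by_cases hy : y ∈ Metric.cthickening ‖e‖ (tsupport ρ.1)
    · rw [indicator_of_mem hy]
      have h1 : |ρ.1 (y - t • e) - ρ.1 y| ≤ K * (|t| * ‖e‖) := by
        have := hK.dist_le_mul (y - t • e) y
        simpa [Real.dist_eq, dist_eq_norm, norm_smul] using this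
      have h2 : |t * (negPartial i ρ).1 y| ≤ |t| * (K * ‖e‖) := by
        rw [abs_mul, negPartial_apply, abs_neg]
        gcongr
        calc ‖fderiv ℝ ρ.1 y e‖ ≤ ‖fderiv ℝ ρ.1 y‖ * ‖e‖ := ContinuousLinearMap.le_opNorm _ _
          _ ≤ K * ‖e‖ := by gcongr; exact norm_fderiv_le_of_lipschitz ℝ hK
      rcases eq_or_ne t 0 with rfl | h0
      · simpa using hnn
      · have h0' : 0 < |t| := abs_pos.2 h0
        rw [inv_mul_le_iff₀ h0']
        calc _ ≤ |ρ.1 (y - t • e) - ρ.1 y| + |t * (negPartial i ρ).1 y| := abs_sub _ _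
          _ ≤ _ := by linarith
    · rw [indicator_of_notMem hy]
      have h1 : y ∉ tsupport ρ.1 := fun h => hy (Metric.self_subset_cthickening _ h)
      have h2 : y - t • e ∉ tsupport ρ.1 := fun h => hy
        (Metric.mem_cthickening_of_dist_le _ _ _ _ h (by
          simpa [dist_eq_norm, norm_smul] using mul_le_of_le_one_left (norm_nonneg e) ht))
      have h3 : (negPartial i ρ).1 y = 0 := by
        rw [negPartial_apply, image_eq_zero_of_notMem_tsupport
          (fun h => h1 (tsupport_fderiv_subset ℝ h))]
        simp
      simp [image_eq_zero_of_notMem_tsupport h1, image_eq_zero_of_notMem_tsupport h2, h3]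
  have hlim : ∀ y, Tendsto (fun t : ℝ =>
      |t|⁻¹ * |ρ.1 (y - t • e) - ρ.1 y - t * (negPartial i ρ).1 y|) (𝓝 0) (𝓝 0) := fun y => by
    have h1 : HasDerivAt (fun t : ℝ => y - t • e) (-e) 0 := by
      simpa using ((hasDerivAt_id (0 : ℝ)).smul_const e).const_sub y
    have h2 : HasFDerivAt ρ.1 (fderiv ℝ ρ.1 y) (y - (0 : ℝ) • e) := by
      simpa using ((differentiable ρ) y).hasFDerivAt
    have h3 := hasDerivAt_iff_tendsto.1 (h2.comp_hasDerivAt 0 h1)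
    simpa [negPartial_apply, Real.norm_eq_abs] using h3
  have := tendsto_integral_filter_of_dominated_convergence (μ := (volume : Measure (RN N))) _
    (F := fun (t : ℝ) y => |t|⁻¹ * |ρ.1 (y - t • e) - ρ.1 y - t * (negPartial i ρ).1 y|)
    (Eventually.of_forall fun t => Continuous.aestronglyMeasurable ?_)
    (hbd.mono fun t ht => Eventually.of_forall ht) hK' (Eventually.of_forall hlim)
  · simpa [integral_const_mul] using this
  · have h1 := (continuous ρ)
    have h2 := continuous (negPartial i ρ)
    fun_prop

end smoothCompact

end TestFunctions

/-! ### Mollification along orbits; density of `C^∞(Ω)`. -/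

namespace DynSystem

theorem abs_indicator_one_le {Ω : Type*} {F : Set Ω} (ω : Ω) :
    |F.indicator (fun _ => (1 : ℝ)) ω| ≤ 1 := by
  by_cases h : ω ∈ F <;> simp [h]

variable {N : ℕ} {Ω : Type*} [MeasurableSpace Ω] {μ : Measure Ω} (T : DynSystem N μ)

/-- The mollification `ω ↦ ∫ ρ(y) 1_F(T(y) ω) dy` of the indicator function of `F`. -/
noncomputable def mollify (F : Set Ω) (ρ : RN N → ℝ) (ω : Ω) : ℝ :=
  ∫ y, ρ y * F.indicator (fun _ => (1 : ℝ)) (T y ω)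

variable {F : Set Ω}

theorem aestronglyMeasurable_indicator_orbit (hF : MeasurableSet F) (ω : Ω) :
    AEStronglyMeasurable (fun y => F.indicator (fun _ => (1 : ℝ)) (T y ω)) volume := by
  have : (fun y => F.indicator (fun _ => (1 : ℝ)) (T y ω)) =
      {y | T y ω ∈ F}.indicator (fun _ => (1 : ℝ)) := rfl
  rw [this]
  exact (aemeasurable_const.indicator₀ (T.nullMeasurable_orbit hF ω)).aestronglyMeasurable

theorem integrable_mul_indicator_orbit (hF : MeasurableSet F) {ρ : RN N → ℝ} (hρ : Integrable ρ)
    (ω : Ω) : Integrable (fun y => ρ y * F.indicator (fun _ => (1 : ℝ)) (T y ω)) :=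
  hρ.mul_bdd (c := 1) (T.aestronglyMeasurable_indicator_orbit hF ω)
    (Eventually.of_forall fun _ => abs_indicator_one_le _)

theorem abs_mollify_le (F : Set Ω) {ρ : RN N → ℝ} (hρ : Integrable ρ) (ω : Ω) :
    |T.mollify F ρ ω| ≤ ∫ y, |ρ y| :=
  norm_integral_le_of_norm_le (g := fun y => |ρ y|)
    (f := fun y => ρ y * F.indicator (fun _ => (1 : ℝ)) (T y ω)) hρ.abs
    (Eventually.of_forall fun y => by
      rw [Real.norm_eq_abs, abs_mul]
      exact mul_le_of_le_one_right (abs_nonneg _) (abs_indicator_one_le _))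

/-- By the group law and translation invariance of Lebesgue measure, moving along the orbit amounts
to translating the kernel. -/
theorem mollify_apply_orbit (F : Set Ω) (ρ : RN N → ℝ) (x : RN N) (ω : Ω) :
    T.mollify F ρ (T x ω) = T.mollify F (fun y => ρ (y - x)) ω := by
  simp only [mollify, ← T.add']
  rw [← integral_add_right_eq_self (μ := (volume : Measure (RN N)))
    (fun y => ρ (y - x) * F.indicator (fun _ => (1 : ℝ)) (T y ω)) x]
  simp

theorem aestronglyMeasurable_mollify [SFinite μ] (hF : MeasurableSet F) {ρ : RN N → ℝ}
    (hρ : AEStronglyMeasurable ρ volume) : AEStronglyMeasurable (T.mollify F ρ) μ := by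
  have hS := T.completionPreserving_shear (ν₀ := volume)
    Measure.AbsolutelyContinuous.rfl one_ne_zero
  have h1 := hS.aestronglyMeasurable_comp (g := fun p => F.indicator (fun _ => (1 : ℝ)) p.2)
    ((measurable_const.indicator hF).comp measurable_snd).aestronglyMeasurable
  have h2 : AEStronglyMeasurable
      (fun p : RN N × Ω => ρ p.1 * F.indicator (fun _ => (1 : ℝ)) (T p.1 p.2))
      ((volume : Measure (RN N)).prod μ) := by
    simp only [shear, one_smul] at h1
    exact hρ.comp_fst.mul h1
  exact h2.prod_swap.integral_prod_right'

theorem memLp_mollify [IsFiniteMeasure μ] (hF : MeasurableSet F) {ρ : RN N → ℝ}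
    (hρ : Integrable ρ) : MemLp (T.mollify F ρ) ∞ μ :=
  memLp_top_of_bound (T.aestronglyMeasurable_mollify hF hρ.1) _
    (Eventually.of_forall fun ω => T.abs_mollify_le F hρ ω)

/-- The difference quotient falls on the kernel, where it is `ρ(y - t eᵢ) - ρ(y)`; hence the sign in
`negPartial`. The `L^∞` norm of a mollification is at most the `L¹` norm of its kernel, so
differentiability of translation in `L¹` suffices. -/
theorem hasStochDeriv_mollify [IsProbabilityMeasure μ] (hF : MeasurableSet F)
    (ρ : smoothCompact N) (i : Fin N) :
    HasStochDeriv T i ((T.memLp_mollify hF (smoothCompact.integrable ρ)).toLp _)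
      ((T.memLp_mollify hF (smoothCompact.integrable (smoothCompact.negPartial i ρ))).toLp _) := by
  set e : RN N := basisVec i
  set σ := smoothCompact.negPartial i ρ
  set A := (T.memLp_mollify hF (smoothCompact.integrable ρ)).toLp _
  set B := (T.memLp_mollify hF (smoothCompact.integrable σ)).toLp _
  have hA : A =ᵐ[μ] T.mollify F ρ.1 := MemLp.coeFn_toLp _
  have hB : B =ᵐ[μ] T.mollify F σ.1 := MemLp.coeFn_toLp _
  have hk : ∀ t : ℝ, koopman T (t • e) A =ᵐ[μ]
      T.mollify F (fun y => ρ.1 (y - t • e)) := fun t => by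
    have h1 : koopman T (t • e) A =ᵐ[μ] A ∘ T (t • e) :=
      Lp.coeFn_compMeasurePreserving _ _
    have h2 := (T.measurePreserving' (t • e)).quasiMeasurePreserving.ae hA
    filter_upwards [h1, h2] with ω h1 h2
    rw [h1, Function.comp_apply, h2, T.mollify_apply_orbit]
  have hρt : ∀ t : ℝ, Integrable (fun y => ρ.1 (y - t • e)) := fun t =>
    (smoothCompact.integrable ρ).comp_sub_right _
  have hbound : ∀ t : ℝ, ‖koopman T (t • e) A - koopman T ((0 : ℝ) • e) A - (t - 0) • B‖ ≤
      ∫ y, |ρ.1 (y - t • e) - ρ.1 y - t * σ.1 y| := fun t => by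
    have hint := ((hρt t).sub (smoothCompact.integrable ρ)).sub
      ((smoothCompact.integrable σ).const_mul t)
    have := Lp.norm_le_of_ae_bound (μ := μ) (p := ∞)
      (f := koopman T (t • e) A - koopman T ((0 : ℝ) • e) A - (t - 0) • B)
      (C := ∫ y, |ρ.1 (y - t • e) - ρ.1 y - t * σ.1 y|)
      (integral_nonneg fun _ => abs_nonneg _) ?_
    · simpa using this
    · filter_upwards [Lp.coeFn_sub (koopman T (t • e) A - koopman T ((0 : ℝ) • e) A) ((t - 0) • B),
        Lp.coeFn_sub (koopman T (t • e) A) (koopman T ((0 : ℝ) • e) A),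
        Lp.coeFn_smul (t - 0) B, hB, hk t, hk 0] with ω h1 h2 h3 h4 h5 h6
      have : T.mollify F (fun y => ρ.1 (y - t • e)) ω - T.mollify F ρ.1 ω - t * T.mollify F σ.1 ω
          = T.mollify F (fun y => ρ.1 (y - t • e) - ρ.1 y - t * σ.1 y) ω := by
        have i1 := T.integrable_mul_indicator_orbit hF (hρt t) ω
        have i2 := T.integrable_mul_indicator_orbit hF (smoothCompact.integrable ρ) ω
        have i3 := T.integrable_mul_indicator_orbit hF
          ((smoothCompact.integrable σ).const_mul t) ω
        have e3 : t * T.mollify F σ.1 ω = T.mollify F (fun y => t * σ.1 y) ω := by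
          simp only [mollify, ← integral_const_mul, mul_assoc]
        rw [e3]
        simp only [mollify]
        have i12 : Integrable (fun y => ρ.1 (y - t • e) * F.indicator (fun _ => (1 : ℝ)) (T y ω) -
          ρ.1 y * F.indicator (fun _ => (1 : ℝ)) (T y ω)) := i1.sub i2
        rw [← integral_sub i1 i2, ← integral_sub i12 i3]
        congr 1
        ext y
        ring
      rw [h1, Pi.sub_apply, h2, Pi.sub_apply, h3, Pi.smul_apply, h4, h5, h6]
      simp only [zero_smul, sub_zero, smul_eq_mul]
      rw [this]
      exact T.abs_mollify_le F hint ω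
  unfold HasStochDeriv
  rw [hasDerivAt_iff_tendsto]
  refine squeeze_zero (fun t => by positivity) (fun t => ?_)
    (smoothCompact.tendsto_integral_translate_sub ρ i)
  rw [sub_zero, Real.norm_eq_abs]
  gcongr
  simpa using hbound t

theorem mollify_mem_smoothSpace [IsProbabilityMeasure μ] (hF : MeasurableSet F)
    (ρ : smoothCompact N) :
    (T.memLp_mollify hF (smoothCompact.integrable ρ)).toLp _ ∈ smoothSpace T := by
  obtain ⟨R, hR0, hR⟩ := smoothCompact.exists_multiindex ρ
  refine ⟨fun α => (T.memLp_mollify hF (smoothCompact.integrable (R α))).toLp _, ?_, ?_⟩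
  · simp only [hR0]
  · intro α i
    simp only [hR]
    exact T.hasStochDeriv_mollify hF (R α) i

/-- Indicator functions of measurable sets are bounded almost sure limits of elements of
`C^∞(Ω)`. -/
theorem exists_smoothSpace_tendsto_indicator [IsProbabilityMeasure μ] (hF : MeasurableSet F) :
    ∃ ψ : ℕ → Ω → ℝ, (∀ k, ∃ g ∈ smoothSpace T, ψ k =ᵐ[μ] g) ∧
      (∀ k, AEStronglyMeasurable (ψ k) μ) ∧ (∀ k ω, |ψ k ω| ≤ 1) ∧
      ∀ᵐ ω ∂μ, Tendsto (fun k => ψ k ω) atTop (𝓝 (F.indicator (fun _ => (1 : ℝ)) ω)) := by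
  let φ : ℕ → ContDiffBump (0 : RN N) := fun k =>
    ⟨1 / ((k : ℝ) + 1), 2 * (1 / ((k : ℝ) + 1)), by positivity, by
      have : 0 < 1 / ((k : ℝ) + 1) := by positivity
      linarith⟩
  let ρ : ℕ → smoothCompact N := fun k =>
    ⟨(φ k).normed volume, (φ k).contDiff_normed, (φ k).hasCompactSupport_normed⟩
  have hm : ∀ k, AEStronglyMeasurable (T.mollify F (ρ k).1) μ := fun k =>
    T.aestronglyMeasurable_mollify hF (smoothCompact.integrable (ρ k)).1
  refine ⟨fun k => T.mollify F (ρ k).1, fun k => ⟨_, T.mollify_mem_smoothSpace hF (ρ k),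
    (MemLp.coeFn_toLp _).symm⟩, hm, fun k ω => ?_, ?_⟩
  · refine (T.abs_mollify_le F (smoothCompact.integrable (ρ k)) ω).trans_eq ?_
    rw [← (φ k).integral_normed (μ := volume)]
    exact integral_congr_ae (Eventually.of_forall fun y => abs_of_nonneg ((φ k).nonneg_normed y))
  -- Along each fixed orbit the mollification is a convolution on `ℝ^N`, which converges at a.e.
  -- point; this is transferred back to almost every `ω`.
  · refine T.ae_of_ae_orbit ?_ (Eventually.of_forall fun ω => ?_)
    · have h1 : MeasurableSet {ω | Tendsto (fun k => (hm k).mk _ ω) atTop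
          (𝓝 (F.indicator (fun _ => (1 : ℝ)) ω))} :=
        measurableSet_tendsto_fun (fun k => (hm k).stronglyMeasurable_mk.measurable)
          (measurable_const.indicator hF)
      refine h1.nullMeasurableSet.congr ?_
      have h2 : ∀ᵐ ω ∂μ, ∀ k, T.mollify F (ρ k).1 ω = (hm k).mk _ ω :=
        ae_all_iff.2 fun k => (hm k).ae_eq_mk
      filter_upwards [h2] with ω hω
      refine propext ?_
      change Tendsto (fun k => (hm k).mk _ ω) atTop _ ↔
        Tendsto (fun k => T.mollify F (ρ k).1 ω) atTop _
      simp only [hω]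
    · have hloc : LocallyIntegrable (fun y => F.indicator (fun _ => (1 : ℝ)) (T y ω)) volume :=
        (locallyIntegrable_const (1 : ℝ)).mono (T.aestronglyMeasurable_indicator_orbit hF ω)
          (Eventually.of_forall fun y => by simpa using abs_indicator_one_le (F := F) (T y ω))
      have hr : Tendsto (fun k => (φ k).rOut) atTop (𝓝 0) := by
        have h := (tendsto_one_div_add_atTop_nhds_zero_nat (𝕜 := ℝ)).const_mul 2
        rwa [mul_zero] at h
      -- `K = 2` is the fixed ratio of outer to inner radius of the bumps.
      have := ContDiffBump.ae_convolution_tendsto_right_of_locallyIntegrable (K := 2) hr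
        (Eventually.of_forall fun k => le_rfl) hloc
      filter_upwards [this] with x hx
      refine hx.congr fun k => ?_
      rw [convolution_lsmul]
      -- A convolution samples at `x - y`, the mollification at `x + y`; the bump is even.
      rw [← integral_neg_eq_self]
      simp only [mollify, ← T.add', smul_eq_mul, sub_neg_eq_add]
      refine integral_congr_ae (Eventually.of_forall fun y => ?_)
      simp only [ρ, (φ k).normed_neg, add_comm]

end DynSystem

/-! ### Consequences of the growth of `Φ`. -/

section Superlinear

namespace YoungFunction

variable (Φ : YoungFunction)

theorem exists_mul_le_add (M : ℝ≥0) : ∃ C : ℝ≥0, ∀ t : ℝ≥0, M * t ≤ Φ t + C := by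
  obtain ⟨t₁, ht₁⟩ := eventually_atTop.1 (Φ.tendsto_top'.eventually_ge_atTop M)
  refine ⟨M * t₁, fun t => ?_⟩
  rcases le_total t₁ t with h | h
  · rcases eq_or_ne t 0 with rfl | h0
    · simp
    · have := (le_div_iff₀ (pos_iff_ne_zero.2 h0)).1 (ht₁ t h)
      exact this.trans (le_add_of_nonneg_right zero_le)
  · exact (mul_le_mul_right h M).trans (le_add_of_nonneg_left zero_le)

theorem measurable : Measurable Φ := Φ.continuous'.measurable

variable {X : Type*} [MeasurableSpace X] {ν : Measure X} {Φ}

/-- Write `c |u| = (c δ)(|u| / δ)`: the `Δ'`-condition separates the factors, so finiteness of the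
modular at one scale gives it at all scales. -/
theorem lintegral_mul_lt_top (hΦ : DeltaPrime Φ) {u : X → ℝ} (hu : MemOrlicz Φ ν u) (c : ℝ≥0) :
    ∫⁻ x, (Φ (c * ‖u x‖₊) : ℝ≥0∞) ∂ν < ∞ := by
  obtain ⟨β, -, hβ⟩ := hΦ
  obtain ⟨-, δ, hδ, hI⟩ := hu
  calc ∫⁻ x, (Φ (c * ‖u x‖₊) : ℝ≥0∞) ∂ν
      ≤ ∫⁻ x, ((β * Φ (c * δ) : ℝ≥0) : ℝ≥0∞) * (Φ (‖u x‖₊ / δ) : ℝ≥0∞) ∂ν := by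
        refine lintegral_mono fun x => ?_
        rw [← ENNReal.coe_mul, ENNReal.coe_le_coe]
        have : c * ‖u x‖₊ = c * δ * (‖u x‖₊ / δ) := by
          field_simp
        rw [this]
        exact hβ _ _
    _ = _ := lintegral_const_mul' _ _ ENNReal.coe_ne_top
    _ < ∞ := ENNReal.mul_lt_top ENNReal.coe_lt_top hI

/-- The Euclidean norm is at most `N` times the largest component, so `Φ(‖W‖)` is at most the sum of
the `Φ(N |Wᵢ|)`. -/
theorem integrable_comp_nnnorm (hΦ : DeltaPrime Φ) {N : ℕ} (hN : 1 ≤ N) {W : X → RN N}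
    (hW : ∀ i, MemOrlicz Φ ν (fun x => W x i)) (hWm : AEStronglyMeasurable W ν) :
    Integrable (fun x => (Φ ‖W x‖₊ : ℝ)) ν := by
  have hm : AEMeasurable (fun x => Φ ‖W x‖₊) ν :=
    Φ.measurable.comp_aemeasurable hWm.nnnorm.aemeasurable
  refine ⟨hm.coe_nnreal_real.aestronglyMeasurable, ?_⟩
  simp only [HasFiniteIntegral, Real.enorm_eq_ofReal (NNReal.coe_nonneg _),
    ENNReal.ofReal_coe_nnreal]
  calc ∫⁻ x, (Φ ‖W x‖₊ : ℝ≥0∞) ∂ν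
      ≤ ∫⁻ x, ∑ i, (Φ (N * ‖W x i‖₊) : ℝ≥0∞) ∂ν := by
        refine lintegral_mono fun x => ?_
        have : Nonempty (Fin N) := ⟨⟨0, hN⟩⟩
        obtain ⟨i, -, hi⟩ := Finset.exists_max_image Finset.univ (fun i => ‖W x i‖₊)
          Finset.univ_nonempty
        have h1 : ‖W x‖₊ ≤ N * ‖W x i‖₊ := by
          have h2 : ‖W x‖ ≤ ∑ j, ‖W x j‖ := by
            have h3 : W x = ∑ j, EuclideanSpace.single j (W x j) := by
              ext j; simp
            conv_lhs => rw [h3]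
            refine (norm_sum_le _ _).trans_eq ?_
            simp
          calc ‖W x‖₊ ≤ ∑ j, ‖W x j‖₊ := by
                rw [← NNReal.coe_le_coe]; simpa using h2
            _ ≤ ∑ j : Fin N, ‖W x i‖₊ := Finset.sum_le_sum fun j hj => hi j hj
            _ = N * ‖W x i‖₊ := by simp
        calc (Φ ‖W x‖₊ : ℝ≥0∞) ≤ (Φ (N * ‖W x i‖₊) : ℝ≥0∞) :=
              ENNReal.coe_le_coe.2 (Φ.mono h1)
          _ ≤ _ := Finset.single_le_sum (f := fun i => (Φ (N * ‖W x i‖₊) : ℝ≥0∞))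
            (fun _ _ => zero_le) (Finset.mem_univ i)
    _ = ∑ i, ∫⁻ x, (Φ (N * ‖W x i‖₊) : ℝ≥0∞) ∂ν := lintegral_finsetSum' _ fun i _ =>
        (Φ.measurable.comp_aemeasurable
          ((hW i).1.nnnorm.aemeasurable.const_mul _)).coe_nnreal_ennreal
    _ < ∞ := by
        rw [ENNReal.sum_lt_top]
        exact fun i _ => lintegral_mul_lt_top hΦ (hW i) N

theorem integrable_of_integrable_comp [IsFiniteMeasure ν] {B : Type*} [NormedAddCommGroup B]
    {W : X → B} (hW : AEStronglyMeasurable W ν)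
    (h : Integrable (fun x => (Φ ‖W x‖₊ : ℝ)) ν) : Integrable W ν := by
  obtain ⟨C, hC⟩ := Φ.exists_mul_le_add 1
  refine (h.add (integrable_const (C : ℝ))).mono' hW (Eventually.of_forall fun x => ?_)
  have := hC ‖W x‖₊
  rw [one_mul, ← NNReal.coe_le_coe] at this
  simpa using this

/-- A bound on `∫ Φ(‖W‖)` controls integrals against bounded functions with small `L¹` norm. -/
theorem exists_abs_integral_mul_le [IsFiniteMeasure ν] (Φ : YoungFunction) (A : ℝ) {η : ℝ}
    (hη : 0 < η) : ∃ K : ℝ, ∀ w : X → ℝ, AEStronglyMeasurable w ν →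
      Integrable (fun x => (Φ ‖w x‖₊ : ℝ)) ν → ∫ x, (Φ ‖w x‖₊ : ℝ) ∂ν ≤ A →
      ∀ d : X → ℝ, AEStronglyMeasurable d ν → (∀ x, |d x| ≤ 2) →
        |∫ x, w x * d x ∂ν| ≤ K * ∫ x, |d x| ∂ν + η := by
  -- Chosen so that `(2 / M)(|A| + 1) = η`; the `2` is the bound on `|d|`, and the `+ 1` keeps `M`
  -- positive.
  set M : ℝ≥0 := Real.toNNReal (2 * (|A| + 1) / η) with hMdef
  have hM0 : 0 < 2 * (|A| + 1) / η := by positivity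
  have hM : (M : ℝ) = 2 * (|A| + 1) / η := Real.coe_toNNReal _ hM0.le
  obtain ⟨C, hC⟩ := Φ.exists_mul_le_add M
  refine ⟨C / M, fun w hw hI hA d hd hd2 => ?_⟩
  have hdi : Integrable d ν := (integrable_const (2 : ℝ)).mono' hd (Eventually.of_forall hd2)
  have hint : Integrable (fun x => 2 / (M : ℝ) * (Φ ‖w x‖₊ : ℝ) + C / M * |d x|) ν :=
    (hI.const_mul _).add (hdi.abs.const_mul _)
  have h1 : |∫ x, w x * d x ∂ν| ≤ ∫ x, (2 / (M : ℝ) * (Φ ‖w x‖₊ : ℝ) + C / M * |d x|) ∂ν := by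
    refine norm_integral_le_of_norm_le (f := fun x => w x * d x) hint
      (Eventually.of_forall fun x => ?_)
    have h2 := hC ‖w x‖₊
    rw [← NNReal.coe_le_coe] at h2
    push_cast at h2
    have hMp : 0 < (M : ℝ) := by rw [hM]; exact hM0
    have h3 : |w x| ≤ (Φ ‖w x‖₊ : ℝ) / M + C / M := by
      rw [← add_div, le_div_iff₀ hMp, mul_comm]
      simpa using h2
    rw [Real.norm_eq_abs, abs_mul]
    have hΦ0 : 0 ≤ (Φ ‖w x‖₊ : ℝ) / M := by positivity
    calc |w x| * |d x| ≤ ((Φ ‖w x‖₊ : ℝ) / M + C / M) * |d x| := by gcongr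
      _ = (Φ ‖w x‖₊ : ℝ) / M * |d x| + C / M * |d x| := by ring
      _ ≤ (Φ ‖w x‖₊ : ℝ) / M * 2 + C / M * |d x| := by gcongr; exact hd2 x
      _ = _ := by ring
  refine h1.trans ?_
  rw [integral_add (hI.const_mul _) (hdi.abs.const_mul _), integral_const_mul, integral_const_mul,
    add_comm]
  gcongr
  calc 2 / (M : ℝ) * ∫ x, (Φ ‖w x‖₊ : ℝ) ∂ν ≤ 2 / M * (|A| + 1) := by
        gcongr
        linarith [le_abs_self A]
    _ = η := by rw [hM]; field_simp

end YoungFunction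

end Superlinear

/-! ### Enlarging the class of test functions under equiintegrability. -/

section WeakConvergence

variable {X : Type*} [MeasurableSpace X] {ν : Measure X} [IsFiniteMeasure ν]
  {ι : Type*} {l : Filter ι} {w : ι → X → ℝ} {w₀ : X → ℝ}

/-- Uniform integrability of a family, in the form in which it is used for limits. -/
def EventuallyEquiintegrable (l : Filter ι) (ν : Measure X) (w : ι → X → ℝ) : Prop :=
  ∀ η : ℝ, 0 < η → ∃ K : ℝ, ∀ᶠ n in l, ∀ d : X → ℝ, AEStronglyMeasurable d ν →
    (∀ x, |d x| ≤ 2) → |∫ x, w n x * d x ∂ν| ≤ K * ∫ x, |d x| ∂ν + η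

/-- A three-term estimate: `hk k → h` in `L¹` by dominated convergence, and equiintegrability makes
the error `∫ w n (h - hk k)` small uniformly for `n` far along `l`. -/
theorem tendsto_integral_mul_of_ae_tendsto (hw : EventuallyEquiintegrable l ν w)
    (hwi : ∀ n, Integrable (w n) ν) (hw₀ : Integrable w₀ ν)
    {h : X → ℝ} {hk : ℕ → X → ℝ} (hhm : AEStronglyMeasurable h ν)
    (hkm : ∀ k, AEStronglyMeasurable (hk k) ν) (hh1 : ∀ x, |h x| ≤ 1) (hk1 : ∀ k x, |hk k x| ≤ 1)
    (hlim : ∀ᵐ x ∂ν, Tendsto (fun k => hk k x) atTop (𝓝 (h x)))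
    (ht : ∀ k, Tendsto (fun n => ∫ x, w n x * hk k x ∂ν) l (𝓝 (∫ x, w₀ x * hk k x ∂ν))) :
    Tendsto (fun n => ∫ x, w n x * h x ∂ν) l (𝓝 (∫ x, w₀ x * h x ∂ν)) := by
  have hD : Tendsto (fun k => ∫ x, |h x - hk k x| ∂ν) atTop (𝓝 0) := by
    have := tendsto_integral_of_dominated_convergence (μ := ν) (fun _ => (2 : ℝ))
      (F := fun k x => |h x - hk k x|) (f := fun _ => 0)
      (fun k => (hhm.sub (hkm k)).norm) (integrable_const _)
      (fun k => Eventually.of_forall fun x => by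
        rw [Real.norm_eq_abs, abs_abs]
        linarith [abs_sub (h x) (hk k x), hh1 x, hk1 k x])
      (hlim.mono fun x hx => by
        have := (tendsto_const_nhds (x := h x)).sub hx
        simpa using this.abs)
    simpa using this
  have hE : Tendsto (fun k => ∫ x, w₀ x * hk k x ∂ν) atTop (𝓝 (∫ x, w₀ x * h x ∂ν)) := by
    refine tendsto_integral_of_dominated_convergence (fun x => |w₀ x|)
      (fun k => hw₀.1.mul (hkm k)) hw₀.abs (fun k => Eventually.of_forall fun x => ?_)
      (hlim.mono fun x hx => hx.const_mul _)
    rw [Real.norm_eq_abs, abs_mul]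
    exact mul_le_of_le_one_right (abs_nonneg _) (hk1 k x)
  rw [Metric.tendsto_nhds]
  intro η hη
  obtain ⟨K, hK⟩ := hw (η / 4) (by positivity)
  have hKD : Tendsto (fun k => K * ∫ x, |h x - hk k x| ∂ν) atTop (𝓝 0) := by
    simpa using hD.const_mul K
  obtain ⟨k, hk2, hk3⟩ := ((hKD.eventually_lt_const (show (0 : ℝ) < η / 4 by positivity)).and
    (Metric.tendsto_nhds.1 hE (η / 4) (by positivity))).exists
  filter_upwards [hK, Metric.tendsto_nhds.1 (ht k) (η / 4) (by positivity)] with n hn1 hn2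
  have h1 := hn1 (fun x => h x - hk k x) (hhm.sub (hkm k)) fun x => by
    linarith [abs_sub (h x) (hk k x), hh1 x, hk1 k x]
  have h2 : ∫ x, w n x * (h x - hk k x) ∂ν =
      ∫ x, w n x * h x ∂ν - ∫ x, w n x * hk k x ∂ν := by
    rw [← integral_sub ((hwi n).mul_bdd hhm (Eventually.of_forall hh1))
      ((hwi n).mul_bdd (hkm k) (Eventually.of_forall (hk1 k)))]
    simp only [mul_sub]
  rw [h2] at h1
  rw [Real.dist_eq] at *
  have := abs_le.1 h1
  have := abs_lt.1 hn2
  have := abs_lt.1 hk3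
  rw [abs_lt]
  constructor <;> linarith

/-- Weak convergence on a `π`-system extends to all measurable sets. -/
theorem tendsto_setIntegral_of_isPiSystem (hw : EventuallyEquiintegrable l ν w)
    (hwi : ∀ n, Integrable (w n) ν) (hw₀ : Integrable w₀ ν) {C : Set (Set X)}
    (hC : ‹MeasurableSpace X› = MeasurableSpace.generateFrom C) (hπ : IsPiSystem C)
    (huniv : univ ∈ C)
    (ht : ∀ A ∈ C, Tendsto (fun n => ∫ x in A, w n x ∂ν) l (𝓝 (∫ x in A, w₀ x ∂ν)))
    {A : Set X} (hA : MeasurableSet A) :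
    Tendsto (fun n => ∫ x in A, w n x ∂ν) l (𝓝 (∫ x in A, w₀ x ∂ν)) := by
  induction A, hA using MeasurableSpace.induction_on_inter hC hπ with
  | empty => simp only [Measure.restrict_empty, integral_zero_measure, tendsto_const_nhds]
  | basic A hA => exact ht A hA
  | compl A hA ih =>
    have := (ht _ huniv).sub ih
    simp only [setIntegral_univ] at this
    simpa only [setIntegral_compl hA (hwi _), setIntegral_compl hA hw₀] using this
  | iUnion A hd hA ih =>
    have hconv : ∀ (B : Set X), MeasurableSet B → ∀ v : X → ℝ,
        ∫ x in B, v x ∂ν = ∫ x, v x * B.indicator (fun _ => (1 : ℝ)) x ∂ν := fun B hB v => by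
      rw [← integral_indicator hB]
      congr 1
      ext x
      by_cases hx : x ∈ B <;> simp [hx]
    have hB : ∀ k, MeasurableSet (⋃ i ∈ Finset.range k, A i) := fun k =>
      Finset.measurableSet_biUnion _ fun i _ => hA i
    have hind : ∀ (B : Set X) x, |B.indicator (fun _ => (1 : ℝ)) x| ≤ 1 := fun B x =>
      DynSystem.abs_indicator_one_le x
    have hmono : Monotone fun k => ⋃ i ∈ Finset.range k, A i := fun k k' h =>
      biUnion_mono (Finset.range_mono h) fun _ _ => le_rfl
    have hU : ⋃ k, ⋃ i ∈ Finset.range k, A i = ⋃ i, A i := by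
      ext x
      simp only [mem_iUnion, Finset.mem_range, exists_prop]
      exact ⟨fun ⟨_, i, _, h⟩ => ⟨i, h⟩, fun ⟨i, h⟩ => ⟨i + 1, i, i.lt_succ_self, h⟩⟩
    simp only [hconv _ (MeasurableSet.iUnion hA)]
    -- Finite partial unions follow by additivity; their indicators increase to that of the whole
    -- union.
    refine tendsto_integral_mul_of_ae_tendsto hw hwi hw₀
      (hk := fun k => (⋃ i ∈ Finset.range k, A i).indicator (fun _ => (1 : ℝ)))
      (measurable_const.indicator (MeasurableSet.iUnion hA)).aestronglyMeasurable
      (fun k => (measurable_const.indicator (hB k)).aestronglyMeasurable)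
      (hind _) (fun k => hind _) (Eventually.of_forall fun x => ?_) fun k => ?_
    · have := hmono.tendsto_indicator _ (fun _ => (1 : ℝ)) x
      rw [hU] at this
      exact this.mono_right (pure_le_nhds _)
    · simp only [← hconv _ (hB k)]
      have hsum : ∀ v : X → ℝ, Integrable v ν →
          ∫ x in ⋃ i ∈ Finset.range k, A i, v x ∂ν = ∑ i ∈ Finset.range k, ∫ x in A i, v x ∂ν :=
        fun v hv => integral_biUnion_finset _ (fun i _ => hA i)
          (fun i _ j _ hij => hd hij) (fun i _ => hv.integrableOn)
      simp only [hsum _ (hwi _), hsum _ hw₀]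
      exact tendsto_finsetSum _ fun i _ => ih i

end WeakConvergence

/-! ### Affine minorants and weak lower semicontinuity. -/

section ConvexIntegrands

variable {N : ℕ} {X : Type*} [MeasurableSpace X]

/-- A convex integrand with growth controlled from below and from above by a Young function. -/
structure IsConvexIntegrand (Φ : YoungFunction) (f : X → RN N → ℝ) (c₁ c₂ : ℝ) : Prop where
  measurable : ∀ ξ, Measurable fun x => f x ξ
  convexOn : ∀ x, ConvexOn ℝ univ (f x)
  lower : ∀ x ξ, c₁ * (Φ ‖ξ‖₊ : ℝ) ≤ f x ξ
  upper : ∀ x ξ, f x ξ ≤ c₂ * (1 + (Φ ‖ξ‖₊ : ℝ))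

namespace IsConvexIntegrand

variable {Φ : YoungFunction} {f : X → RN N → ℝ} {c₁ c₂ : ℝ}

theorem continuous (hf : IsConvexIntegrand Φ f c₁ c₂) (x : X) : Continuous (f x) :=
  continuousOn_univ.1 ((hf.convexOn x).continuousOn isOpen_univ)

theorem measurable_uncurry (hf : IsConvexIntegrand Φ f c₁ c₂) :
    Measurable (fun p : X × RN N => f p.1 p.2) := by
  have h := measurable_uncurry_of_continuous_of_measurable (u := fun ξ x => f x ξ)
    (fun x => hf.continuous x) hf.measurable
  exact h.comp measurable_swap

/-- Superlinearity lets `c₁ Φ(‖ξ‖)` absorb `‖q‖ ‖ξ‖` up to a constant, uniformly in `x`. -/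
theorem exists_lower_bound (hf : IsConvexIntegrand Φ f c₁ c₂) (h₁ : 0 < c₁) (q : RN N) :
    ∃ C : ℝ, ∀ x ξ, -C ≤ f x ξ - inner ℝ q ξ := by
  obtain ⟨C, hC⟩ := Φ.exists_mul_le_add (‖q‖₊ / ⟨c₁, h₁.le⟩)
  refine ⟨c₁ * C, fun x ξ => ?_⟩
  have h1 := hC ‖ξ‖₊
  rw [← NNReal.coe_le_coe] at h1
  push_cast at h1
  have h2 : ‖q‖ * ‖ξ‖ ≤ c₁ * (Φ ‖ξ‖₊ + C) := by
    have : ‖q‖ * ‖ξ‖ = c₁ * (‖q‖ / c₁ * ‖ξ‖) := by field_simp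
    rw [this]
    exact mul_le_mul_of_nonneg_left h1 h₁.le
  have h3 := real_inner_le_norm q ξ
  have h4 := hf.lower x ξ
  linarith

/-- The largest `b` such that `⟪q, ξ⟫ + b ≤ f x ξ` for all `ξ`. -/
noncomputable def affineConst (f : X → RN N → ℝ) (q : RN N) (x : X) : ℝ :=
  ⨅ k : ℕ, (f x (TopologicalSpace.denseSeq (RN N) k) -
    inner ℝ q (TopologicalSpace.denseSeq (RN N) k))

theorem measurable_affineConst (hf : IsConvexIntegrand Φ f c₁ c₂) (q : RN N) :
    Measurable (affineConst f q) :=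
  Measurable.iInf fun _ => (hf.measurable _).sub measurable_const

theorem bddBelow_affineConst (hf : IsConvexIntegrand Φ f c₁ c₂) (h₁ : 0 < c₁) (q : RN N) (x : X) :
    BddBelow (range fun k : ℕ => f x (TopologicalSpace.denseSeq (RN N) k) -
      inner ℝ q (TopologicalSpace.denseSeq (RN N) k)) := by
  obtain ⟨C, hC⟩ := hf.exists_lower_bound h₁ q
  exact ⟨-C, by rintro _ ⟨k, rfl⟩; exact hC x _⟩

/-- The infimum in `affineConst` runs over a countable set for the sake of measurability; continuity
of `f x` extends the inequality from the dense sequence to all `ξ`. -/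
theorem inner_add_affineConst_le (hf : IsConvexIntegrand Φ f c₁ c₂) (h₁ : 0 < c₁) (q : RN N)
    (x : X) (ξ : RN N) : inner ℝ q ξ + affineConst f q x ≤ f x ξ := by
  have hcl : IsClosed {ξ : RN N | inner ℝ q ξ + affineConst f q x ≤ f x ξ} :=
    isClosed_le (by fun_prop) (hf.continuous x)
  have hsub : range (TopologicalSpace.denseSeq (RN N)) ⊆
      {ξ : RN N | inner ℝ q ξ + affineConst f q x ≤ f x ξ} := by
    rintro _ ⟨k, rfl⟩
    have := ciInf_le (hf.bddBelow_affineConst h₁ q x) k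
    simp only [mem_ofPred_eq, affineConst]
    linarith
  exact hcl.closure_subset_iff.2 hsub (TopologicalSpace.denseRange_denseSeq (RN N) ξ)

theorem le_affineConst {X : Type*} {f : X → RN N → ℝ} {q : RN N} {x : X} {b : ℝ}
    (h : ∀ ξ, inner ℝ q ξ + b ≤ f x ξ) :
    b ≤ affineConst f q x :=
  le_ciInf fun k => by linarith [h (TopologicalSpace.denseSeq (RN N) k)]

theorem exists_abs_affineConst_le (hf : IsConvexIntegrand Φ f c₁ c₂) (h₁ : 0 < c₁) (q : RN N) :
    ∃ C : ℝ, ∀ x, |affineConst f q x| ≤ C := by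
  obtain ⟨C, hC⟩ := hf.exists_lower_bound h₁ q
  refine ⟨max C (c₂ * (1 + (Φ 0 : ℝ))), fun x => abs_le.2 ⟨?_, ?_⟩⟩
  · have : -C ≤ affineConst f q x := le_ciInf fun k => hC x _
    linarith [le_max_left C (c₂ * (1 + (Φ 0 : ℝ)))]
  · have h2 := hf.inner_add_affineConst_le h₁ q x 0
    have h3 := hf.upper x 0
    simp only [inner_zero_right, zero_add, nnnorm_zero] at h2 h3
    exact (h2.trans h3).trans (le_max_right _ _)

/-- The optimal constant is minus the convex conjugate of `f x`: it is concave in `q`, and a finite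
concave function on `ℝ^N` is continuous. -/
theorem continuous_affineConst (hf : IsConvexIntegrand Φ f c₁ c₂) (h₁ : 0 < c₁) (x : X) :
    Continuous (fun q => affineConst f q x) := by
  have : ConcaveOn ℝ univ (fun q => affineConst f q x) := by
    refine ⟨convex_univ, fun q _ q' _ a b ha hb hab => le_affineConst fun ξ => ?_⟩
    have h2 := mul_le_mul_of_nonneg_left (hf.inner_add_affineConst_le h₁ q x ξ) ha
    have h3 := mul_le_mul_of_nonneg_left (hf.inner_add_affineConst_le h₁ q' x ξ) hb
    rw [inner_add_left, real_inner_smul_left, real_inner_smul_left, smul_eq_mul, smul_eq_mul]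
    have h4 : a * f x ξ + b * f x ξ = f x ξ := by rw [← add_mul, hab, one_mul]
    linarith
  exact continuousOn_univ.1 (this.continuousOn isOpen_univ)

/-- Hahn–Banach yields a slope that works, and continuity in the slope allows moving it into the
dense sequence. Thus one countable family of slopes recovers `f x` for every `x`. -/
theorem exists_lt_inner_add_affineConst (hf : IsConvexIntegrand Φ f c₁ c₂) (h₁ : 0 < c₁) (x : X)
    {ξ : RN N} {r : ℝ} (hr : r < f x ξ) :
    ∃ j : ℕ, r < inner ℝ (TopologicalSpace.denseSeq (RN N) j) ξ +
      affineConst f (TopologicalSpace.denseSeq (RN N) j) x := by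
  obtain ⟨a, hra, haf⟩ := exists_between hr
  obtain ⟨L, b, hLb, hab⟩ := ConvexOn.exists_affine_le_of_lt (𝕜 := ℝ) (mem_univ ξ) haf isClosed_univ
    ((hf.continuous x).lowerSemicontinuous.lowerSemicontinuousOn _) (hf.convexOn x)
  set p : RN N := (InnerProductSpace.toDual ℝ (RN N)).symm L with hp
  have hpL : ∀ η, inner ℝ p η = L η := fun η => InnerProductSpace.toDual_symm_apply
  have hb : b ≤ affineConst f p x := le_affineConst fun η => by
    rw [hpL]
    simpa using hLb ⟨η, mem_univ η⟩
  have hlt : r < inner ℝ p ξ + affineConst f p x := by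
    rw [hpL]
    simp only [RCLike.re_to_real] at hab
    linarith
  have hopen : IsOpen {q : RN N | r < inner ℝ q ξ + affineConst f q x} :=
    isOpen_lt continuous_const
      ((continuous_id.inner continuous_const).add (hf.continuous_affineConst h₁ x))
  obtain ⟨j, hj⟩ := (TopologicalSpace.denseRange_denseSeq (RN N)).exists_mem_open hopen ⟨p, hlt⟩
  exact ⟨j, hj⟩

variable {ν : Measure X}

theorem aestronglyMeasurable_comp (hf : IsConvexIntegrand Φ f c₁ c₂) {W : X → RN N}
    (hW : AEStronglyMeasurable W ν) : AEStronglyMeasurable (fun x => f x (W x)) ν :=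
  (hf.measurable_uncurry.comp_aemeasurable
    (aemeasurable_id.prodMk hW.aemeasurable)).aestronglyMeasurable

theorem nonneg (hf : IsConvexIntegrand Φ f c₁ c₂) (h₁ : 0 < c₁) (x : X) (ξ : RN N) : 0 ≤ f x ξ :=
  (mul_nonneg h₁.le (NNReal.coe_nonneg _)).trans (hf.lower x ξ)

theorem integrable_comp [IsFiniteMeasure ν] (hf : IsConvexIntegrand Φ f c₁ c₂) (h₁ : 0 < c₁)
    {W : X → RN N} (hW : AEStronglyMeasurable W ν)
    (hΦ : Integrable (fun x => (Φ ‖W x‖₊ : ℝ)) ν) : Integrable (fun x => f x (W x)) ν :=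
  (((integrable_const (1 : ℝ)).add hΦ).const_mul c₂).mono' (hf.aestronglyMeasurable_comp hW)
    (Eventually.of_forall fun x => by
      rw [Real.norm_eq_abs, abs_of_nonneg (hf.nonneg h₁ x _)]
      exact hf.upper x _)

/-- `m` is a limit, in the sense of integrals over measurable sets, of minorants of `F n`. -/
def IsMinorantLimit {ι : Type*} (l : Filter ι) (ν : Measure X) (F : ι → X → ℝ) (m : X → ℝ) :
    Prop :=
  Measurable m ∧ Integrable m ν ∧ ∃ g : ι → X → ℝ, (∀ n, Integrable (g n) ν) ∧
    (∀ n x, g n x ≤ F n x) ∧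
    ∀ A, MeasurableSet A → Tendsto (fun n => ∫ x in A, g n x ∂ν) l (𝓝 (∫ x in A, m x ∂ν))

/-- Use the minorants of `m` on `{m' ≤ m}` and those of `m'` on its complement. This set does not
depend on `n`, and convergence over all measurable sets survives the cutting. -/
theorem IsMinorantLimit.sup {ι : Type*} {l : Filter ι} {F : ι → X → ℝ} {m m' : X → ℝ}
    (h : IsMinorantLimit l ν F m) (h' : IsMinorantLimit l ν F m') :
    IsMinorantLimit l ν F (m ⊔ m') := by
  classical
  obtain ⟨hm, hi, g, hgi, hgF, hg⟩ := h
  obtain ⟨hm', hi', g', hgi', hgF', hg'⟩ := h'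
  have hS : MeasurableSet {x | m' x ≤ m x} := measurableSet_le hm' hm
  refine ⟨hm.sup hm', hi.sup hi', fun n => {x | m' x ≤ m x}.piecewise (g n) (g' n),
    fun n => Integrable.piecewise hS (hgi n).integrableOn (hgi' n).integrableOn, fun n x => ?_,
    fun A hA => ?_⟩
  · by_cases hx : x ∈ {x | m' x ≤ m x}
    · simpa [piecewise_eq_of_mem _ _ _ hx] using hgF n x
    · simpa [piecewise_eq_of_notMem _ _ _ hx] using hgF' n x
  · have hsplit : ∀ u v : X → ℝ, Integrable u ν → Integrable v ν →
        ∫ x in A, {x | m' x ≤ m x}.piecewise u v x ∂ν =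
          ∫ x in {x | m' x ≤ m x} ∩ A, u x ∂ν + ∫ x in {x | m' x ≤ m x}ᶜ ∩ A, v x ∂ν :=
      fun u v hu hv => by
        rw [integral_piecewise hS hu.restrict.integrableOn hv.restrict.integrableOn,
          Measure.restrict_restrict hS, Measure.restrict_restrict hS.compl]
    have hmax : m ⊔ m' = {x | m' x ≤ m x}.piecewise m m' := by
      ext x
      by_cases hx : m' x ≤ m x
      · rw [piecewise_eq_of_mem _ _ _ (show x ∈ {x | m' x ≤ m x} from hx)]
        exact max_eq_left hx
      · rw [piecewise_eq_of_notMem _ _ _ (show x ∉ {x | m' x ≤ m x} from hx)]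
        exact max_eq_right (not_le.1 hx).le
    rw [hmax]
    simp only [hsplit _ _ (hgi _) (hgi' _), hsplit _ _ hi hi']
    exact (hg _ (hS.inter hA)).add (hg' _ (hS.compl.inter hA))

theorem setIntegral_inner {W : X → RN N} (hW : Integrable W ν) (q : RN N) (A : Set X) :
    ∫ x in A, inner ℝ q (W x) ∂ν = ∑ i, q i * ∫ x in A, W x i ∂ν := by
  have hWi : ∀ i, Integrable (fun x => W x i) ν := fun i =>
    (EuclideanSpace.proj (𝕜 := ℝ) i).integrable_comp hW
  simp only [PiLp.inner_apply]
  rw [integral_finsetSum _ fun i _ => ?_]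
  · simp [integral_const_mul, mul_comm]
  · simpa [mul_comm] using ((hWi i).const_mul (q i)).restrict (s := A)

/-- Weak lower semicontinuity of convex integral functionals. -/
theorem integral_le_of_tendsto [IsFiniteMeasure ν] (hf : IsConvexIntegrand Φ f c₁ c₂)
    (h₁ : 0 < c₁) {ι : Type*} {l : Filter ι} [l.NeBot] {W : ι → X → RN N} {V : X → RN N}
    (hW : ∀ n, Integrable (W n) ν) (hfW : ∀ n, Integrable (fun x => f x (W n x)) ν)
    (hV : Integrable V ν) (hVm : Measurable V) (hfV : Integrable (fun x => f x (V x)) ν)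
    (hlim : ∀ i A, MeasurableSet A →
      Tendsto (fun n => ∫ x in A, W n x i ∂ν) l (𝓝 (∫ x in A, V x i ∂ν)))
    {c : ℝ} (hc : ∀ᶠ n in l, ∫ x, f x (W n x) ∂ν ≤ c) : ∫ x, f x (V x) ∂ν ≤ c := by
  set q := TopologicalSpace.denseSeq (RN N)
  set a : ℕ → X → ℝ := fun j x => inner ℝ (q j) (V x) + affineConst f (q j) x with ha
  have hbi : ∀ j, Integrable (affineConst f (q j)) ν := fun j => by
    obtain ⟨C, hC⟩ := hf.exists_abs_affineConst_le h₁ (q j)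
    exact (integrable_const C).mono' (hf.measurable_affineConst (q j)).aestronglyMeasurable
      (Eventually.of_forall hC)
  have hbase : ∀ j, IsMinorantLimit l ν (fun n x => f x (W n x)) (a j) := fun j => by
    refine ⟨(Measurable.const_inner hVm).add (hf.measurable_affineConst (q j)),
      (hV.const_inner (q j)).add (hbi j),
      fun n x => inner ℝ (q j) (W n x) + affineConst f (q j) x,
      fun n => ((hW n).const_inner (q j)).add (hbi j),
      fun n x => hf.inner_add_affineConst_le h₁ (q j) x _, fun A hA => ?_⟩
    have hsplit : ∀ U : X → RN N, Integrable U ν →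
        ∫ x in A, (inner ℝ (q j) (U x) + affineConst f (q j) x) ∂ν =
          ∑ i, q j i * ∫ x in A, U x i ∂ν + ∫ x in A, affineConst f (q j) x ∂ν := fun U hU => by
      rw [integral_add (hU.const_inner (q j)).restrict (hbi j).restrict,
        setIntegral_inner hU]
    simp only [ha, hsplit _ (hW _), hsplit _ hV]
    exact (tendsto_finsetSum _ fun i _ => (hlim i A hA).const_mul _).add_const _
  -- Finite maxima of the affine minorants increase to `f x (V x)`, which brings the problem within
  -- reach of monotone convergence.
  have hsup : ∀ k, IsMinorantLimit l ν (fun n x => f x (W n x)) (partialSups a k) := fun k => by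
    induction k with
    | zero => simpa using hbase 0
    | succ k ih =>
      rw [partialSups_add_one]
      exact ih.sup (hbase _)
  have hle : ∀ k, ∫ x, partialSups a k x ∂ν ≤ c := fun k => by
    obtain ⟨-, -, g, hgi, hgF, hg⟩ := hsup k
    have h2 := hg univ MeasurableSet.univ
    simp only [setIntegral_univ] at h2
    refine le_of_tendsto h2 (hc.mono fun n hn => ?_)
    exact (integral_mono (hgi n) (hfW n) (hgF n)).trans hn
  have hlimit : Tendsto (fun k => ∫ x, partialSups a k x ∂ν) atTop (𝓝 (∫ x, f x (V x) ∂ν)) := by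
    refine integral_tendsto_of_tendsto_of_monotone (fun k => (hsup k).2.1) hfV
      (Eventually.of_forall fun x => fun i j hij => (partialSups a).monotone hij x)
      (Eventually.of_forall fun x => ?_)
    refine tendsto_order.2 ⟨fun r hr => ?_, fun r hr => ?_⟩
    · obtain ⟨j, hj⟩ := hf.exists_lt_inner_add_affineConst h₁ x hr
      filter_upwards [eventually_ge_atTop j] with k hk
      exact hj.trans_le (le_partialSups_of_le a hk x)
    · refine Eventually.of_forall fun k => lt_of_le_of_lt ?_ hr
      exact partialSups_le a k (fun x => f x (V x))
        (fun j _ x => hf.inner_add_affineConst_le h₁ (q j) x _) x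
  exact le_of_tendsto' hlimit hle

end IsConvexIntegrand

end ConvexIntegrands

/-! ### From smooth tensor test functions to measurable sets. -/

section TwoScale

variable {N : ℕ}

/-- Indicator functions of open subsets of `Q` are bounded pointwise limits of test functions. -/
theorem exists_isTestFunction_tendsto_indicator {Q V : Set (RN N)} (hQb : Bornology.IsBounded Q)
    (hV : IsOpen V) (hVQ : V ⊆ Q) :
    ∃ φ : ℕ → RN N → ℝ, (∀ k, IsTestFunction Q (φ k)) ∧ (∀ k x, |φ k x| ≤ 1) ∧
      ∀ x, Tendsto (fun k => φ k x) atTop (𝓝 (V.indicator (fun _ => (1 : ℝ)) x)) := by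
  -- With `g` positive exactly on `V`, the cut-off `smoothTransition (k g - 1)` is zero where `k g ≤
  -- 1` and one where `k g ≥ 2`, so its closed support lies in `{1 ≤ k g} ⊆ V`.
  obtain ⟨g, hgV, hg, hgr⟩ := hV.exists_contDiff_support_eq (n := ⊤)
  have hg0 : ∀ x, 0 ≤ g x := fun x => (hgr (mem_range_self x)).1
  have hsupp : ∀ k : ℕ, tsupport (fun x => Real.smoothTransition (k * g x - 1)) ⊆
      {x | 1 ≤ k * g x} := fun k => by
    refine closure_minimal (fun x hx => ?_) (isClosed_le continuous_const (by
      have := hg.continuous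
      fun_prop))
    by_contra hlt
    exact hx (Real.smoothTransition.zero_of_nonpos (by
      have : ¬ (1 ≤ k * g x) := hlt
      linarith))
  have hsub : ∀ k : ℕ, {x | 1 ≤ k * g x} ⊆ V := fun k x hx => by
    rw [← hgV]
    intro h0
    have hx' : 1 ≤ k * g x := hx
    rw [h0] at hx'
    linarith
  refine ⟨fun k x => Real.smoothTransition (k * g x - 1), fun k => ⟨?_, ?_, ?_⟩, fun k x => ?_,
    fun x => ?_⟩
  · exact Real.smoothTransition.contDiff.comp ((contDiff_const.mul hg).sub contDiff_const)
  · exact Metric.isCompact_of_isClosed_isBounded (isClosed_tsupport _)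
      (hQb.subset ((hsupp k).trans ((hsub k).trans hVQ)))
  · exact (hsupp k).trans ((hsub k).trans hVQ)
  · rw [abs_of_nonneg (Real.smoothTransition.nonneg _)]
    exact Real.smoothTransition.le_one _
  · by_cases hx : x ∈ V
    · have hgx : 0 < g x := lt_of_le_of_ne (hg0 x) (fun h => by
        rw [← hgV] at hx
        exact hx h.symm)
      rw [indicator_of_mem hx]
      refine tendsto_const_nhds.congr' ?_
      have hlim : Tendsto (fun k : ℕ => (k : ℝ) * g x) atTop atTop :=
        tendsto_natCast_atTop_atTop.atTop_mul_const hgx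
      filter_upwards [hlim.eventually_ge_atTop 2] with k hk
      exact (Real.smoothTransition.one_of_one_le (by linarith)).symm
    · rw [indicator_of_notMem hx]
      have : g x = 0 := by
        by_contra h
        exact hx (hgV ▸ h)
      simp only [this, mul_zero, zero_sub]
      rw [Real.smoothTransition.zero_of_nonpos (by norm_num)]
      exact tendsto_const_nhds

variable {Ω : Type*} [MeasurableSpace Ω] {μ : Measure Ω}

theorem IsTensor.aestronglyMeasurable {T : DynSystem N μ} {Q : Set (RN N)} {h : RN N × Ω → ℝ}
    (hh : IsTensor Q {a | ∃ ψ ∈ smoothSpace T, a =ᵐ[μ] ψ} h) :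
    AEStronglyMeasurable h (cylMeasure Q μ) := by
  obtain ⟨m, φ, a, hφ, ha, rfl⟩ := hh
  refine Finset.aestronglyMeasurable_fun_sum _ fun j _ => ?_
  obtain ⟨ψ, -, hψ⟩ := ha j
  exact ((hφ j).1.continuous.aestronglyMeasurable (μ := volume.restrict Q)).comp_fst.mul
    ((Lp.aestronglyMeasurable ψ).congr hψ.symm).comp_snd

variable [IsProbabilityMeasure μ]

theorem isFiniteMeasure_cylMeasure {Q : Set (RN N)} (hQb : Bornology.IsBounded Q) :
    IsFiniteMeasure (cylMeasure Q μ) := by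
  have : IsFiniteMeasure ((volume : Measure (RN N)).restrict Q) :=
    ⟨by rw [Measure.restrict_apply_univ]; exact hQb.measure_lt_top⟩
  unfold cylMeasure
  infer_instance

/-- Convergence against `C_0^∞(Q) ⊗ C^∞(Ω)` of an equiintegrable family implies convergence of the
integrals over all measurable sets. -/
theorem tendsto_setIntegral_of_isTensor (T : DynSystem N μ) {Q : Set (RN N)} (hQo : IsOpen Q)
    (hQb : Bornology.IsBounded Q) {ι : Type*} {l : Filter ι} {w : ι → RN N × Ω → ℝ}
    {w₀ : RN N × Ω → ℝ} (hw : EventuallyEquiintegrable l (cylMeasure Q μ) w)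
    (hwi : ∀ n, Integrable (w n) (cylMeasure Q μ)) (hw₀ : Integrable w₀ (cylMeasure Q μ))
    (ht : ∀ h, IsTensor Q {a | ∃ ψ ∈ smoothSpace T, a =ᵐ[μ] ψ} h →
      Tendsto (fun n => ∫ p, w n p * h p ∂(cylMeasure Q μ)) l
        (𝓝 (∫ p, w₀ p * h p ∂(cylMeasure Q μ))))
    {A : Set (RN N × Ω)} (hA : MeasurableSet A) :
    Tendsto (fun n => ∫ p in A, w n p ∂(cylMeasure Q μ)) l
      (𝓝 (∫ p in A, w₀ p ∂(cylMeasure Q μ))) := by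
  have := isFiniteMeasure_cylMeasure (μ := μ) hQb
  have hgen := generateFrom_eq_prod (C := {U : Set (RN N) | IsOpen U})
    (D := {F : Set Ω | MeasurableSet F})
    (BorelSpace.measurable_eq (α := RN N)).symm MeasurableSpace.generateFrom_measurableSet
    ⟨fun _ => univ, fun _ => by simp, iUnion_const _⟩ isCountablySpanning_measurableSet
  refine tendsto_setIntegral_of_isPiSystem hw hwi hw₀ hgen.symm
    (isPiSystem_isOpen.prod MeasurableSpace.isPiSystem_measurableSet)
    ⟨univ, by simp, univ, by simp, univ_prod_univ⟩ ?_ hA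
  rintro _ ⟨U, hU, F, hF, rfl⟩
  have hU : IsOpen U := hU
  have hF : MeasurableSet F := hF
  -- Test functions must be supported in `Q`, so `U` is cut down to `U ∩ Q`; the measure does not
  -- see the rest.
  obtain ⟨φ, hφ, hφ1, hφU⟩ := exists_isTestFunction_tendsto_indicator hQb (hU.inter hQo)
    inter_subset_right
  obtain ⟨ψ, hψ, hψm, hψ1, hψF⟩ := T.exists_smoothSpace_tendsto_indicator hF
  set h : RN N × Ω → ℝ := fun p => (U ∩ Q).indicator (fun _ => (1 : ℝ)) p.1 *
    F.indicator (fun _ => (1 : ℝ)) p.2 with hh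
  have hmul : ∀ a b : ℝ, |a| ≤ 1 → |b| ≤ 1 → |a * b| ≤ 1 := fun a b ha hb => by
    rw [abs_mul]
    exact mul_le_one₀ ha (abs_nonneg _) hb
  have hQae : ∀ᵐ p ∂(cylMeasure Q μ), p.1 ∈ Q :=
    Measure.quasiMeasurePreserving_fst.ae (ae_restrict_mem hQo.measurableSet)
  have hconv : ∀ v : RN N × Ω → ℝ, ∫ p in U ×ˢ F, v p ∂(cylMeasure Q μ) =
      ∫ p, v p * h p ∂(cylMeasure Q μ) := fun v => by
    rw [← integral_indicator (hU.measurableSet.prod hF)]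
    refine integral_congr_ae ?_
    filter_upwards [hQae] with p hp
    by_cases h1 : p.1 ∈ U <;> by_cases h2 : p.2 ∈ F <;> simp [hh, h1, h2, hp]
  simp only [hconv]
  have hhm : Measurable h :=
    ((measurable_const.indicator (hU.inter hQo).measurableSet).comp measurable_fst).mul
      ((measurable_const.indicator hF).comp measurable_snd)
  refine tendsto_integral_mul_of_ae_tendsto hw hwi hw₀ (hk := fun k p => φ k p.1 * ψ k p.2)
    hhm.aestronglyMeasurable (fun k => ?_)
    (fun p => hmul _ _ (DynSystem.abs_indicator_one_le _) (DynSystem.abs_indicator_one_le _))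
    (fun k p => hmul _ _ (hφ1 k _) (hψ1 k _)) ?_ fun k => ht _ ?_
  · exact ((hφ k).1.continuous.aestronglyMeasurable (μ := volume.restrict Q)).comp_fst.mul
      (hψm k).comp_snd
  · have : ∀ᵐ p ∂(cylMeasure Q μ), Tendsto (fun k => ψ k p.2) atTop
        (𝓝 (F.indicator (fun _ => (1 : ℝ)) p.2)) := Measure.quasiMeasurePreserving_snd.ae hψF
    filter_upwards [this] with p hp
    exact (hφU p.1).mul hp
  · exact ⟨1, fun _ => φ k, fun _ => ψ k, fun _ => hφ k, fun _ => hψ k, by simp⟩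

end TwoScale

/-! ### Removing the oscillation and concluding. -/

section Homogenization

variable {N : ℕ}

theorem aestronglyMeasurable_of_components {X : Type*} [MeasurableSpace X] {ν : Measure X}
    {W : X → RN N} (hW : ∀ i, AEStronglyMeasurable (fun x => W x i) ν) :
    AEStronglyMeasurable W ν := by
  have h : W = fun x => ∑ i, W x i • (basisVec i : RN N) := by
    ext x j
    simp [basisVec, Pi.single_apply]
  rw [h]
  exact Finset.aestronglyMeasurable_fun_sum _ fun i _ => (hW i).smul_const _

/-- De la Vallée Poussin's criterion: a superlinear function of each component has bounded
integrals. -/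
theorem EventuallyEquiintegrable.of_integral_young_le {X : Type*} [MeasurableSpace X]
    {ν : Measure X} [IsFiniteMeasure ν] {Φ : YoungFunction} {ι : Type*} {l : Filter ι}
    {W : ι → X → RN N} (hW : ∀ n, AEStronglyMeasurable (W n) ν)
    (hΦ : ∀ n, Integrable (fun x => (Φ ‖W n x‖₊ : ℝ)) ν) {A : ℝ}
    (hA : ∀ᶠ n in l, ∫ x, (Φ ‖W n x‖₊ : ℝ) ∂ν ≤ A) (i : Fin N) :
    EventuallyEquiintegrable l ν (fun n x => W n x i) := by
  intro η hη
  obtain ⟨K, hK⟩ := Φ.exists_abs_integral_mul_le (ν := ν) A hη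
  refine ⟨K, hA.mono fun n hn => ?_⟩
  have hm : AEStronglyMeasurable (fun x => W n x i) ν :=
    (EuclideanSpace.proj (𝕜 := ℝ) i).continuous.comp_aestronglyMeasurable (hW n)
  have hle : ∀ x, (Φ ‖W n x i‖₊ : ℝ) ≤ Φ ‖W n x‖₊ := fun x =>
    NNReal.coe_le_coe.2 (Φ.mono (by
      rw [← NNReal.coe_le_coe]
      exact PiLp.norm_apply_le (W n x) i))
  have hi : Integrable (fun x => (Φ ‖W n x i‖₊ : ℝ)) ν :=
    (hΦ n).mono' (Φ.measurable.comp_aemeasurable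
      hm.nnnorm.aemeasurable).coe_nnreal_real.aestronglyMeasurable
      (Eventually.of_forall fun x => by simpa using hle x)
  exact hK _ hm hi ((integral_mono hi (hΦ n) hle).trans hn)

/-- An almost surely convex integrand agrees, on a measurable set of full measure, with an
everywhere convex one. -/
theorem exists_isConvexIntegrand {Ω : Type*} [MeasurableSpace Ω] {μ : Measure Ω}
    [IsProbabilityMeasure μ] {Φ : YoungFunction} {f : Ω → RN N → ℝ}
    (hf₁ : ∀ ξ, Measurable (fun ω => f ω ξ)) (hf₂ : ∀ᵐ ω ∂μ, ConvexOn ℝ univ (f ω)) {c₁ c₂ : ℝ}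
    (hf₃ : ∀ᵐ ω ∂μ, ∀ ξ,
      c₁ * (Φ ‖ξ‖₊ : ℝ) ≤ f ω ξ ∧ f ω ξ ≤ c₂ * (1 + (Φ ‖ξ‖₊ : ℝ))) :
    ∃ f' : Ω → RN N → ℝ, IsConvexIntegrand Φ f' c₁ c₂ ∧ ∀ᵐ ω ∂μ, f ω = f' ω := by
  classical
  obtain ⟨s, hs, hsm, hgood⟩ := (hf₂.and hf₃).exists_measurable_mem
  -- Off the good set `s`, `f ω` is replaced by `f ω₀` for one fixed good `ω₀`.
  obtain ⟨ω₀, hω₀⟩ := (show ∀ᵐ ω ∂μ, ω ∈ s from hs).exists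
  have hmem : ∀ ω, (if ω ∈ s then ω else ω₀) ∈ s := fun ω => by
    split_ifs with h
    · exact h
    · exact hω₀
  refine ⟨fun ω => f (if ω ∈ s then ω else ω₀), ⟨fun ξ => (hf₁ ξ).comp
    (Measurable.ite hsm measurable_id measurable_const), fun ω => (hgood _ (hmem ω)).1,
    fun ω ξ => ((hgood _ (hmem ω)).2 ξ).1, fun ω ξ => ((hgood _ (hmem ω)).2 ξ).2⟩, ?_⟩
  filter_upwards [hs] with ω hω
  simp [hω]

theorem IsConvexIntegrand.comp {X Y : Type*} [MeasurableSpace X] [MeasurableSpace Y]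
    {Φ : YoungFunction} {f : X → RN N → ℝ} {c₁ c₂ : ℝ} (hf : IsConvexIntegrand Φ f c₁ c₂)
    {π : Y → X} (hπ : Measurable π) : IsConvexIntegrand Φ (fun y => f (π y)) c₁ c₂ :=
  ⟨fun ξ => (hf.measurable ξ).comp hπ, fun _ => hf.convexOn _, fun _ => hf.lower _,
    fun _ => hf.upper _⟩

variable {Ω : Type*} [MeasurableSpace Ω] {μ : Measure Ω} [IsProbabilityMeasure μ]

/-- Lower semicontinuity under weak stochastic two-scale convergence, for sequences of vector
fields. -/
theorem StochTwoScaleTendsto.integral_le_liminf (T : DynSystem N μ) {Φ : YoungFunction}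
    (hN : 1 ≤ N) (hΦ : DeltaPrime Φ) {Q : Set (RN N)} (hQo : IsOpen Q)
    (hQb : Bornology.IsBounded Q) {f : Ω → RN N → ℝ} {c₁ c₂ : ℝ}
    (hf : IsConvexIntegrand Φ f c₁ c₂) (h₁ : 0 < c₁) {ε : ℕ → ℝ} (hε : ∀ n, ε n ≠ 0)
    {v : ℕ → RN N × Ω → RN N} {v₀ : RN N × Ω → RN N}
    (hconv : ∀ i, StochTwoScaleTendsto Φ Q T ε (fun n p => v n p i) (fun p => v₀ p i)) :
    Integrable (fun p => f p.2 (v₀ p)) (cylMeasure Q μ) ∧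
    (∀ n, Integrable (fun p => f (T ((ε n)⁻¹ • p.1) p.2) (v n p)) (cylMeasure Q μ)) ∧
    ((∫ p, f p.2 (v₀ p) ∂(cylMeasure Q μ) : ℝ) : EReal) ≤
      liminf (fun n =>
        ((∫ p, f (T ((ε n)⁻¹ • p.1) p.2) (v n p) ∂(cylMeasure Q μ) : ℝ) : EReal)) atTop := by
  set ν := cylMeasure Q μ with hν
  have := isFiniteMeasure_cylMeasure (μ := μ) hQb
  have hg : IsConvexIntegrand Φ (fun p : RN N × Ω => f p.2) c₁ c₂ := hf.comp measurable_snd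
  have hvm : ∀ n, AEStronglyMeasurable (v n) ν := fun n =>
    aestronglyMeasurable_of_components fun i => ((hconv i).1 n).1
  have hv₀m : AEStronglyMeasurable v₀ ν :=
    aestronglyMeasurable_of_components fun i => (hconv i).2.1.1
  have hvΦ : ∀ n, Integrable (fun p => (Φ ‖v n p‖₊ : ℝ)) ν := fun n =>
    YoungFunction.integrable_comp_nnnorm hΦ hN (fun i => (hconv i).1 n) (hvm n)
  have hv₀Φ : Integrable (fun p => (Φ ‖v₀ p‖₊ : ℝ)) ν :=
    YoungFunction.integrable_comp_nnnorm hΦ hN (fun i => (hconv i).2.1) hv₀m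
  have hS : ∀ c : ℝ, c ≠ 0 → CompletionPreserving (T.shear c) ν := fun c hc =>
    T.completionPreserving_shear (Measure.restrict_le_self.absolutelyContinuous) hc
  have hε' : ∀ n, (ε n)⁻¹ ≠ 0 := fun n => inv_ne_zero (hε n)
  have hSp : ∀ n, CompletionPreserving (T.shear (ε n)⁻¹) ν := fun n => hS _ (hε' n)
  have hSm : ∀ n, CompletionPreserving (T.shear (-(ε n)⁻¹)) ν := fun n =>
    hS _ (neg_ne_zero.2 (hε' n))
  -- The inverse shear moves the oscillation from the integrand into the field.
  set W : ℕ → RN N × Ω → RN N := fun n p => v n (T.shear (-(ε n)⁻¹) p) with hWdef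
  have hWm : ∀ n, AEStronglyMeasurable (W n) ν := fun n =>
    (hSm n).aestronglyMeasurable_comp (hvm n)
  have hWΦ : ∀ n, Integrable (fun p => (Φ ‖W n p‖₊ : ℝ)) ν := fun n =>
    (hSm n).integrable_comp (hvΦ n)
  have hWi : ∀ n, Integrable (W n) ν := fun n =>
    YoungFunction.integrable_of_integrable_comp (hWm n) (hWΦ n)
  have hv₀i : Integrable v₀ ν := YoungFunction.integrable_of_integrable_comp hv₀m hv₀Φ
  have hfW : ∀ n, Integrable (fun p => f p.2 (W n p)) ν := fun n =>
    hg.integrable_comp h₁ (hWm n) (hWΦ n)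
  have hfv₀ : Integrable (fun p => f p.2 (v₀ p)) ν := hg.integrable_comp h₁ hv₀m hv₀Φ
  have hfv : ∀ n, (fun p => f (T ((ε n)⁻¹ • p.1) p.2) (v n p)) =
      fun p => f (T.shear (ε n)⁻¹ p).2 (W n (T.shear (ε n)⁻¹ p)) := fun n => by
    ext p
    simp only [hWdef, T.shear_neg_shear]
    rfl
  have hint : ∀ n, ∫ p, f (T ((ε n)⁻¹ • p.1) p.2) (v n p) ∂ν = ∫ p, f p.2 (W n p) ∂ν :=
    fun n => by
      rw [hfv]
      exact (hSp n).integral_comp (hfW n).1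
  refine ⟨hfv₀, fun n => ?_, ?_⟩
  · rw [hfv]
    exact (hSp n).integrable_comp (hfW n)
  by_contra hlt
  obtain ⟨c, hc1, hc2⟩ := EReal.lt_iff_exists_real_btwn.1 (not_le.1 hlt)
  have hfreq : ∃ᶠ n in atTop, ∫ p, f p.2 (W n p) ∂ν < c := by
    refine (frequently_lt_of_liminf_lt (by isBoundedDefault) hc1).mono fun n hn => ?_
    rw [← hint]
    exact EReal.coe_lt_coe_iff.1 hn
  -- This filter plays the part of a subsequence with energies below `c`: limits along `atTop`
  -- persist, and the energy bound holds eventually.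
  set l : Filter ℕ := atTop ⊓ 𝓟 {n | ∫ p, f p.2 (W n p) ∂ν < c}
  have : l.NeBot := frequently_mem_iff_neBot.1 hfreq
  have hl : ∀ᶠ n in l, ∫ p, f p.2 (W n p) ∂ν ≤ c := by
    have : ∀ᶠ n in l, n ∈ {n | ∫ p, f p.2 (W n p) ∂ν < c} :=
      Filter.mem_of_superset (mem_inf_of_right (mem_principal_self _)) fun _ h => h
    exact this.mono fun n hn => le_of_lt hn
  have hlΦ : ∀ᶠ n in l, ∫ p, (Φ ‖W n p‖₊ : ℝ) ∂ν ≤ c / c₁ := hl.mono fun n hn => by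
    rw [le_div_iff₀ h₁, mul_comm, ← integral_const_mul]
    exact (integral_mono ((hWΦ n).const_mul _) (hfW n) fun p => hg.lower p _).trans hn
  have hweak : ∀ i A, MeasurableSet A →
      Tendsto (fun n => ∫ p in A, W n p i ∂ν) l (𝓝 (∫ p in A, v₀ p i ∂ν)) := by
    intro i A hA
    refine tendsto_setIntegral_of_isTensor T hQo hQb
      (EventuallyEquiintegrable.of_integral_young_le hWm hWΦ hlΦ i)
      (fun n => (EuclideanSpace.proj (𝕜 := ℝ) i).integrable_comp (hWi n))
      ((EuclideanSpace.proj (𝕜 := ℝ) i).integrable_comp hv₀i) (fun h hh => ?_) hA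
    -- Changing variables by the inverse shear turns the oscillating test function into `h` itself
    -- and `v n` into `W n`.
    refine (((hconv i).2.2 h hh).mono_left inf_le_left).congr fun n => ?_
    have hm : AEStronglyMeasurable (fun p => v n p i * h (T.shear (ε n)⁻¹ p)) ν :=
      (((hconv i).1 n).1).mul ((hSp n).aestronglyMeasurable_comp hh.aestronglyMeasurable)
    have := (hSm n).integral_comp hm
    simp only [T.shear_shear_neg] at this
    exact this.symm
  -- A measurable representative of `v₀` makes the sets where affine minorants are compared
  -- measurable.
  have hle := hg.integral_le_of_tendsto h₁ (V := hv₀m.mk v₀) hWi hfW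
    (hv₀i.congr hv₀m.ae_eq_mk) hv₀m.stronglyMeasurable_mk.measurable
    (hfv₀.congr (hv₀m.ae_eq_mk.mono fun p hp => by simp only [← hp]))
    (fun i A hA => by
      have : ∫ p in A, hv₀m.mk v₀ p i ∂ν = ∫ p in A, v₀ p i ∂ν :=
        integral_congr_ae (ae_restrict_of_ae (hv₀m.ae_eq_mk.mono fun p hp => by
          simp only [← hp]))
      rw [this]
      exact hweak i A hA) hl
  have heq : ∫ p, f p.2 (hv₀m.mk v₀ p) ∂ν = ∫ p, f p.2 (v₀ p) ∂ν :=
    integral_congr_ae (hv₀m.ae_eq_mk.mono fun p hp => by simp only [← hp])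
  rw [heq] at hle
  exact absurd (EReal.coe_lt_coe_iff.1 hc2) (not_lt.2 hle)

end Homogenization

theorem corollary4 {N : ℕ} (hN : 1 ≤ N)
    {Ω : Type*} [MeasurableSpace Ω] {μ : Measure Ω} [IsProbabilityMeasure μ]
    (T : DynSystem N μ)
    (Φ : YoungFunction)
    (hΦ₂ : DeltaTwo Φ) (hΦ' : DeltaPrime Φ)
    (hΦc₂ : DeltaTwo (fenchelConj Φ)) (hΦc' : DeltaPrime (fenchelConj Φ))
    (Q : Set (RN N)) (hQo : IsOpen Q) (hQb : Bornology.IsBounded Q)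
    (f : Ω → RN N → ℝ)
    (hf₁ : ∀ ξ, Measurable (fun ω => f ω ξ))
    (hf₂ : ∀ᵐ ω ∂μ, StrictConvexOn ℝ univ (f ω))
    (hf₃ : ∃ c₁ c₂ : ℝ, 0 < c₁ ∧ 0 < c₂ ∧ ∀ᵐ ω ∂μ, ∀ ξ,
      c₁ * (Φ ‖ξ‖₊ : ℝ) ≤ f ω ξ ∧ f ω ξ ≤ c₂ * (1 + (Φ ‖ξ‖₊ : ℝ)))
    (ε : ℕ → ℝ) (hε : IsFundamentalSequence ε)
    (u : ℕ → RN N × Ω → ℝ) (Du : ℕ → RN N × Ω → RN N)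
    (hu : ∀ n, MemW1 Φ Q μ (u n)) (hDu : ∀ n, HasWeakGradient Φ Q μ (u n) (Du n))
    (u₀ : RN N × Ω → ℝ) (u₁ : RN N → WSharp Φ T) (hu₀₁ : MemF10 Φ Q T u₀ u₁)
    (Du₀ Dωu₁ : RN N × Ω → RN N)
    (hDu₀ : HasWeakGradient Φ Q μ u₀ Du₀) (hDωu₁ : IsSharpGradientField Φ Q T u₁ Dωu₁)
    (hconv : ∀ i, StochTwoScaleTendsto Φ Q T ε (fun n p => Du n p i)
      (fun p => (Du₀ p + Dωu₁ p) i)) :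
    Integrable (fun p => f p.2 (Du₀ p + Dωu₁ p)) (cylMeasure Q μ) ∧
    (∀ n, Integrable (fun p => f (T ((ε n)⁻¹ • p.1) p.2) (Du n p)) (cylMeasure Q μ)) ∧
    ((∫ p, f p.2 (Du₀ p + Dωu₁ p) ∂(cylMeasure Q μ) : ℝ) : EReal) ≤
      liminf (fun n =>
        ((∫ p, f (T ((ε n)⁻¹ • p.1) p.2) (Du n p) ∂(cylMeasure Q μ) : ℝ) : EReal)) atTop := by
  obtain ⟨c₁, c₂, h₁, -, hf₃⟩ := hf₃
  obtain ⟨f', hf', hff'⟩ := exists_isConvexIntegrand hf₁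
    (hf₂.mono fun ω h => h.convexOn) hf₃
  have hε0 : ∀ n, ε n ≠ 0 := fun n => (hε.1 n).1.ne'
  obtain ⟨hi, hin, hle⟩ := StochTwoScaleTendsto.integral_le_liminf T hN hΦ' hQo hQb hf' h₁ hε0
    hconv
  have hsnd : ∀ᵐ p ∂(cylMeasure Q μ), f p.2 = f' p.2 :=
    Measure.quasiMeasurePreserving_snd.ae hff'
  have h0 : (fun p => f' p.2 (Du₀ p + Dωu₁ p)) =ᵐ[cylMeasure Q μ]
      fun p => f p.2 (Du₀ p + Dωu₁ p) := hsnd.mono fun p hp => by simp only [hp]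
  have hn : ∀ n, (fun p => f' (T ((ε n)⁻¹ • p.1) p.2) (Du n p)) =ᵐ[cylMeasure Q μ]
      fun p => f (T ((ε n)⁻¹ • p.1) p.2) (Du n p) := fun n => by
    have hS : CompletionPreserving (T.shear (ε n)⁻¹) (cylMeasure Q μ) :=
      T.completionPreserving_shear (Measure.restrict_le_self.absolutelyContinuous)
        (inv_ne_zero (hε0 n))
    -- The shear pulls null sets back to null sets, so `f` and `f'` also agree at `T(x/ε) ω` for
    -- almost every `(x, ω)`.
    exact (hS.ae hsnd).mono fun p hp => (congrFun hp (Du n p)).symm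
  refine ⟨hi.congr h0, fun n => (hin n).congr (hn n), ?_⟩
  rw [← integral_congr_ae h0]
  simp only [← integral_congr_ae (hn _)]
  exact hle
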